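/- For real numbers $x_1,\dots,x_N$ ($N\ge 1$, counted with multiplicity) let \[ D_N(x_1,\dots,x_N)=\sup_{0\le\alpha\le\beta\le 1}\left|\frac{\#\{1\le n\le N:\ \alpha\le\{x_n\}<\beta\}}{N}-(\beta-\alpha)\right| \] denote their discrepancy, where $\{x\}$ is the fractional part of $x$. Let $d\ge 0$ be an integer. There is a constant $C_d>0$, depending only on $d$, such that for every polynomial $P(n)=z_dn^d+\cdots+z_1n+z_0$ of degree $d$ with integer coefficients and every integer $q\ge 1$, \[ D_q\left(\frac{P(1)}{q},\frac{P(2)}{q},\dots,\frac{P(q)}{q}\right)\le C_d\left(\frac{q}{\gcd(z_1,\dots,z_d,q)}\right)^{-1/(d+1)}. \] (For $d=0$ the greatest common divisor is $q$, and the zero polynomial is allowed.) -/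

import Mathlib

/-- The quantities whose supremum is the discrepancy of the real numbers `x 1, …, x N`
(counted with multiplicity): the deviations
`|#{1 ≤ n ≤ N : α ≤ {x n} < β} / N - (β - α)|` for `0 ≤ α ≤ β ≤ 1`. -/
def discrepancyDeviations (N : ℕ) (x : ℕ → ℝ) : Set ℝ :=
  {r : ℝ | ∃ α β : ℝ, 0 ≤ α ∧ α ≤ β ∧ β ≤ 1 ∧
    r = |(({n : ℕ | n ∈ Finset.Icc 1 N ∧ α ≤ Int.fract (x n) ∧ Int.fract (x n) < β}.ncard : ℕ) : ℝ)
          / (N : ℝ) - (β - α)|}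

/-- The discrepancy `D_N (x 1, …, x N)`. -/
noncomputable def discrepancy (N : ℕ) (x : ℕ → ℝ) : ℝ :=
  sSup (discrepancyDeviations N x)

/-- `gcd (z_1, …, z_d, q)` for the coefficients `z_j` of an integer polynomial `P`; the constant
coefficient `z_0` does not enter. -/
noncomputable def coeffGcd (d : ℕ) (P : Polynomial ℤ) (q : ℕ) : ℕ :=
  Nat.gcd ((Finset.Icc 1 d).gcd fun j => (P.coeff j).natAbs) q

open Polynomial

/-! Let g be the gcd, q = g q' and P = r + g f with 0 ≤ r < g. Then {P(n)/q} = (r + g (f(n) mod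
q'))/q, so an interval for the fractional parts becomes an interval of residues for f(n) mod q', up
to a rounding error of 1. Since g is the full gcd, f is nonconstant modulo every prime dividing q'.
If all these residue counts deviate from their expected values by at most E, the discrepancy is at
most (E + 1)/q'.

Finite Fourier analysis modulo q' (`abs_card_sub_le_sum_norm`) bounds E by the complete sums S(k) =
∑ e(k f(n)/q') weighted by 1/k + 1/(q' - k). Hua's bound S ≪ q^(1 - 1/d + ε)
(`exists_norm_completeExpSum_le`), applied after cancelling gcd(k, q'), gives E ≪ q'^(1 - 1/d + 3ε):
the weights cost only a divisor function and a logarithm. As 1/(d+1) < 1/d, some ε > 0 makes the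
exponent exactly 1 - 1/(d+1). The case d = 0 is trivial.

Hua's bound is proved in three stages. For a prime, Mordell's method compares |S|^(2d) with a mean
value over all polynomials, which Newton's identities evaluate. For a prime power, only zeros of the
normalised derivative modulo p contribute; expanding f around each one lowers the exponent, and
`norm_completeExpSum_prime_pow_aux` controls the branching by multiplicities of zeros. For general
q, the Chinese remainder theorem multiplies the bounds, and the accumulated constant A^ω(q) is
O(q^ε). -/

/-! ### Power sums and Newton's identities -/

theorem addChar_map_sum {A M ι : Type*} [AddCommMonoid A] [CommMonoid M] (ψ : AddChar A M)
    (s : Finset ι) (g : ι → A) : ψ (∑ i ∈ s, g i) = ∏ i ∈ s, ψ (g i) := by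
  classical
  induction s using Finset.induction_on with
  | empty => simp
  | insert a s ha ih => rw [Finset.sum_insert ha, Finset.prod_insert ha, AddChar.map_add_eq_mul, ih]

/-- Newton's identities express k e_k through power sums and lower e_i. As k is invertible for 1 ≤ k
≤ d, the power sums determine all e_k, hence ∏ (X - x_i) and its roots. -/
theorem map_eq_map_of_powerSums_eq {K : Type*} [Field K] {d : ℕ}
    (hK : ∀ j : ℕ, 1 ≤ j → j ≤ d → (j : K) ≠ 0) (x y : Fin d → K)
    (h : ∀ j : ℕ, 1 ≤ j → j ≤ d → ∑ i, x i ^ j = ∑ i, y i ^ j) :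
    (Finset.univ.val.map x) = Finset.univ.val.map y := by
  classical
  have key : ∀ k : ℕ, k ≤ d → MvPolynomial.aeval x (MvPolynomial.esymm (Fin d) K k) =
      MvPolynomial.aeval y (MvPolynomial.esymm (Fin d) K k) := by
    intro k
    induction k using Nat.strong_induction_on with
    | _ k ih =>
      intro hk
      rcases Nat.eq_zero_or_pos k with rfl | hpos
      · simp
      · apply mul_left_cancel₀ (hK k hpos hk)
        have hx := congrArg (MvPolynomial.aeval x) (MvPolynomial.mul_esymm_eq_sum (Fin d) K k)
        have hy := congrArg (MvPolynomial.aeval y) (MvPolynomial.mul_esymm_eq_sum (Fin d) K k)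
        simp only [map_mul, map_natCast, map_sum, map_pow, map_neg, map_one,
          MvPolynomial.psum, MvPolynomial.aeval_X] at hx hy
        rw [hx, hy]
        congr 1
        apply Finset.sum_congr rfl
        rintro ⟨a, b⟩ hab
        rw [Finset.mem_filter, Finset.HasAntidiagonal.mem_antidiagonal] at hab
        simp only at hab
        rw [ih a hab.2 (by omega), h b (by omega) (by omega)]
  have hprod : ((Finset.univ.val.map x).map fun t => X - C t).prod =
      ((Finset.univ.val.map y).map fun t => X - C t).prod := by
    rw [Multiset.prod_X_sub_X_eq_sum_esymm, Multiset.prod_X_sub_X_eq_sum_esymm]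
    simp only [Multiset.card_map, Finset.card_val, Finset.card_univ, Fintype.card_fin]
    apply Finset.sum_congr rfl
    intro j hj
    rw [← MvPolynomial.aeval_esymm_eq_multiset_esymm (Fin d) K,
      ← MvPolynomial.aeval_esymm_eq_multiset_esymm (Fin d) K,
      key j (by simpa [Nat.lt_succ_iff] using hj)]
  simpa only [Polynomial.roots_multiset_prod_X_sub_C] using congrArg Polynomial.roots hprod

theorem card_map_eq_map_le_factorial {K : Type*} [DecidableEq K] [Fintype K] {d : ℕ}
    (x : Fin d → K) :
    (Finset.univ.filter fun y : Fin d → K =>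
      Finset.univ.val.map x = Finset.univ.val.map y).card ≤ d.factorial := by
  classical
  calc _ ≤ (List.ofFn x).permutations.toFinset.card := by
        apply Finset.card_le_card_of_injOn List.ofFn
        · intro y hy
          simp only [Finset.coe_filter, Finset.mem_univ, true_and, Set.mem_ofPred_eq,
            Fin.univ_val_map, Multiset.coe_eq_coe] at hy
          simpa using hy.symm
        · exact fun a _ b _ hab => List.ofFn_injective hab
    _ ≤ (List.ofFn x).permutations.length := List.toFinset_card_le _
    _ = d.factorial := by rw [List.length_permutations, List.length_ofFn]

/-! ### Mordell's bound over a finite field -/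

section
variable {K : Type*} [Field K] [Fintype K]

theorem sum_addChar_dotProduct [DecidableEq K] {d : ℕ} {ψ : AddChar K ℂ} (hψ : ψ.IsPrimitive) (c : Fin d → K) :
    ∑ a : Fin d → K, ψ (∑ j, a j * c j) = if c = 0 then (Fintype.card K : ℂ) ^ d else 0 := by
  have h1 : ∀ a : Fin d → K, ψ (∑ j, a j * c j) = ∏ j, ψ (a j * c j) := fun a => by
    rw [addChar_map_sum]
  simp only [h1]
  rw [← Fintype.piFinset_univ,
    ← Finset.prod_univ_sum (fun _ : Fin d => (Finset.univ : Finset K)) (fun j t => ψ (t * c j))]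
  simp only [AddChar.sum_mulShift _ hψ]
  split_ifs with hc
  · simp [hc]
  · obtain ⟨j, hj⟩ := Function.ne_iff.mp hc
    exact Finset.prod_eq_zero (Finset.mem_univ j) (by simpa using hj)

/-- Expanding the 2d-th power and summing over all coefficient vectors leaves, by orthogonality,
|K|^d times the number of pairs (x, y) with equal power sums. For each x such a y is a
rearrangement, so there are at most d! of them. -/
theorem sum_norm_weylSum_pow_le [DecidableEq K] {d : ℕ} (hK : ∀ j : ℕ, 1 ≤ j → j ≤ d → (j : K) ≠ 0)
    {ψ : AddChar K ℂ} (hψ : ψ.IsPrimitive) :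
    ∑ a : Fin d → K, ‖∑ x, ψ (∑ j, a j * x ^ (j.1 + 1))‖ ^ (2 * d) ≤
      (Fintype.card K : ℝ) ^ d * (d.factorial * (Fintype.card K : ℝ) ^ d) := by
  have h1 : ∀ a : Fin d → K, ((‖∑ x, ψ (∑ j, a j * x ^ (j.1 + 1))‖ ^ (2 * d) : ℝ) : ℂ) =
      ∑ x : Fin d → K, ∑ y : Fin d → K,
        ψ (∑ j : Fin d, a j * (∑ i, x i ^ (j.1 + 1) - ∑ i, y i ^ (j.1 + 1))) := by
    intro a
    rw [pow_mul]
    push_cast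
    rw [← Complex.mul_conj', mul_pow, map_sum]
    simp only [← AddChar.map_neg_eq_conj]
    rw [Fintype.sum_pow, Fintype.sum_pow, Fintype.sum_mul_sum]
    refine Finset.sum_congr rfl fun x _ => Finset.sum_congr rfl fun y _ => ?_
    simp only [← addChar_map_sum, ← AddChar.map_add_eq_mul]
    congr 1
    rw [Finset.sum_neg_distrib, ← sub_eq_add_neg, Finset.sum_comm]
    nth_rw 2 [Finset.sum_comm]
    simp only [← Finset.mul_sum, ← Finset.sum_sub_distrib, ← mul_sub]
  have h2 : ((∑ a : Fin d → K, ‖∑ x, ψ (∑ j, a j * x ^ (j.1 + 1))‖ ^ (2 * d) : ℝ) : ℂ) =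
      ((∑ x : Fin d → K, (((Finset.univ.filter fun y : Fin d → K =>
        (fun j : Fin d => (∑ i, x i ^ (j.1 + 1) - ∑ i, y i ^ (j.1 + 1))) = 0).card : ℝ) *
          (Fintype.card K : ℝ) ^ d) : ℝ) : ℂ) := by
    push_cast
    simp only [Complex.ofReal_pow] at h1
    simp only [h1]
    rw [Finset.sum_comm]
    refine Finset.sum_congr rfl fun x _ => ?_
    rw [Finset.sum_comm]
    simp only [sum_addChar_dotProduct hψ]
    rw [← Finset.sum_filter, Finset.sum_const, nsmul_eq_mul]
  rw [Complex.ofReal_inj.mp h2, ← Finset.sum_mul, mul_comm]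
  gcongr
  calc _ ≤ ∑ x : Fin d → K, (d.factorial : ℝ) := by
        gcongr with x
        refine le_trans (Finset.card_le_card ?_) (card_map_eq_map_le_factorial x)
        intro y hy
        simp only [Finset.mem_filter, Finset.mem_univ, true_and] at hy ⊢
        refine map_eq_map_of_powerSums_eq hK x y fun j hj hjd => ?_
        have := congrFun hy ⟨j - 1, by omega⟩
        simp only [Pi.zero_apply, sub_eq_zero, Nat.sub_add_cancel hj] at this
        exact this
    _ = _ := by simp [mul_comm]

/-- The vector lists the nonconstant coefficients of f(l x + m). The top one fixes l^d, leaving at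
most d values of l; the next one is affine in m with slope d · lead(f) ≠ 0 (up to a power of l), so
it fixes m. For d ≥ 2 that second coefficient is not the constant term. -/
theorem card_affine_fiber_le [DecidableEq K] {d : ℕ} (hd : 2 ≤ d) (hK : (d : K) ≠ 0) {f : K[X]}
    (hf : f.natDegree = d) (a : Fin d → K) :
    (Finset.univ.filter fun t : K × K => t.1 ≠ 0 ∧
      (fun j : Fin d => t.1 ^ (j.1 + 1) * (taylor t.2 f).coeff (j.1 + 1)) = a).card ≤ d := by
  have hlead : f.coeff d ≠ 0 := by
    rw [← hf]; exact leadingCoeff_ne_zero.mpr (by rintro rfl; simp at hf; omega)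
  have hc : ∀ μ : K, (taylor μ f).coeff d = f.coeff d := by
    intro μ; rw [← hf]; exact coeff_taylor_natDegree _ _
  have hc' : ∀ μ : K, (taylor μ f).coeff (d - 1) = f.coeff (d - 1) + d * f.coeff d * μ := by
    intro μ
    rw [taylor_coeff, eval_eq_sum_range' (n := 2), Finset.sum_range_succ, Finset.sum_range_one]
    · simp only [hasseDeriv_coeff]
      have : 1 + (d - 1) = d := by omega
      rw [this]
      have h3 : d.choose (d - 1) = d := by
        rw [Nat.choose_symm_of_eq_add (show d = (d - 1) + 1 by omega)]; simp
      simp [h3]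
    · have := natDegree_hasseDeriv_le f (d - 1)
      omega
  calc _ ≤ (nthRoots d (a ⟨d - 1, by omega⟩ / f.coeff d)).toFinset.card := by
        apply Finset.card_le_card_of_injOn Prod.fst
        · rintro ⟨l, m⟩ h
          simp only [Finset.coe_filter, Finset.mem_univ, true_and, Set.mem_ofPred_eq] at h
          have h2 := congrFun h.2 ⟨d - 1, by omega⟩
          simp only [show d - 1 + 1 = d by omega, hc] at h2
          simp only [Multiset.mem_toFinset, Finset.mem_coe]
          rw [mem_nthRoots (by omega), eq_div_iff hlead, h2]
        · rintro ⟨l, m⟩ h ⟨l', m'⟩ h' hll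
          simp only [Finset.coe_filter, Finset.mem_univ, true_and, Set.mem_ofPred_eq] at h h' hll
          subst hll
          have h2 := congrFun (h.2.trans h'.2.symm) ⟨d - 2, by omega⟩
          simp only [show d - 2 + 1 = d - 1 by omega, hc'] at h2
          have h3 := add_left_cancel (mul_left_cancel₀ (pow_ne_zero _ h.1) h2)
          have h4 := mul_left_cancel₀ (mul_ne_zero hK hlead) h3
          rw [h4]
    _ ≤ Multiset.card (nthRoots d (a ⟨d - 1, by omega⟩ / f.coeff d)) := Multiset.toFinset_card_le _
    _ ≤ d := card_nthRoots _ _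

theorem norm_sum_affine_eq {d : ℕ} {f : K[X]} (hf : f.natDegree = d) (ψ : AddChar K ℂ)
    {l : K} (hl : l ≠ 0) (m : K) :
    ‖∑ x, ψ (∑ j : Fin d, (l ^ (j.1 + 1) * (taylor m f).coeff (j.1 + 1)) * x ^ (j.1 + 1))‖ =
      ‖∑ x, ψ (f.eval x)‖ := by
  have h1 : ∀ x, f.eval (l * x + m) = f.eval m +
      ∑ j : Fin d, (l ^ (j.1 + 1) * (taylor m f).coeff (j.1 + 1)) * x ^ (j.1 + 1) := by
    intro x
    rw [← taylor_eval, eval_eq_sum_range, natDegree_taylor, hf, Finset.sum_range_succ',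
      Finset.sum_range, add_comm]
    congr 1
    · simp
    · refine Finset.sum_congr rfl fun j _ => ?_
      rw [mul_pow]; ring
  have h2 : ∑ x, ψ (f.eval x) = ∑ x, ψ (f.eval (l * x + m)) :=
    (Fintype.sum_equiv ((Equiv.mulLeft₀ l hl).trans (Equiv.addRight m)) _ _ (fun x => by simp)).symm
  rw [h2]
  simp only [h1, AddChar.map_add_eq_mul, ← Finset.mul_sum, norm_mul, AddChar.norm_apply, one_mul]

/-- All |K|(|K| - 1) invertible affine substitutions preserve the modulus of the sum, and each
coefficient vector arises from at most d of them. Hence |K|(|K| - 1) copies of one term fit into d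
times the mean value. -/
theorem norm_sum_addChar_pow_le [DecidableEq K] {d : ℕ} (hd : 2 ≤ d) (hK : ∀ j : ℕ, 1 ≤ j → j ≤ d → (j : K) ≠ 0)
    {ψ : AddChar K ℂ} (hψ : ψ.IsPrimitive) {f : K[X]} (hf : f.natDegree = d) :
    ‖∑ x, ψ (f.eval x)‖ ^ (2 * d) * (Fintype.card K * (Fintype.card K - 1)) ≤
      d * ((Fintype.card K : ℝ) ^ d * (d.factorial * (Fintype.card K : ℝ) ^ d)) := by
  set T : Finset (K × K) := Finset.univ.filter fun t => t.1 ≠ 0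
  set c : K × K → Fin d → K := fun t j => t.1 ^ (j.1 + 1) * (taylor t.2 f).coeff (j.1 + 1)
  have hT : (T.card : ℝ) = Fintype.card K * (Fintype.card K - 1) := by
    have : T = (Finset.univ.erase 0) ×ˢ Finset.univ := by
      ext ⟨a, b⟩; simp [T]
    rw [this, Finset.card_product, Finset.card_erase_of_mem (Finset.mem_univ _), Finset.card_univ]
    push_cast [Nat.cast_sub Fintype.card_pos]
    ring
  calc _ = ∑ t ∈ T, ‖∑ x, ψ (∑ j, c t j * x ^ (j.1 + 1))‖ ^ (2 * d) := by
        rw [← hT, mul_comm, ← nsmul_eq_mul, ← Finset.sum_const]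
        refine Finset.sum_congr rfl fun t ht => ?_
        rw [norm_sum_affine_eq hf ψ (Finset.mem_filter.mp ht).2]
    _ = ∑ a : Fin d → K, ∑ t ∈ T with c t = a, ‖∑ x, ψ (∑ j, c t j * x ^ (j.1 + 1))‖ ^ (2 * d) :=
        (Finset.sum_fiberwise _ _ _).symm
    _ ≤ ∑ a : Fin d → K, d * ‖∑ x, ψ (∑ j, a j * x ^ (j.1 + 1))‖ ^ (2 * d) := by
        refine Finset.sum_le_sum fun a _ => ?_
        rw [Finset.sum_congr rfl (g := fun _ => ‖∑ x, ψ (∑ j, a j * x ^ (j.1 + 1))‖ ^ (2 * d))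
          (fun t ht => by rw [(Finset.mem_filter.mp ht).2]), Finset.sum_const, nsmul_eq_mul]
        gcongr
        rw [Finset.filter_filter]
        exact card_affine_fiber_le hd (hK d (by omega) le_rfl) hf a
    _ ≤ _ := by
        rw [← Finset.mul_sum]
        gcongr
        exact sum_norm_weylSum_pow_le hK hψ

theorem norm_sum_addChar_le [DecidableEq K] {d : ℕ} (hd : 1 ≤ d) (hK : ∀ j : ℕ, 1 ≤ j → j ≤ d → (j : K) ≠ 0)
    {ψ : AddChar K ℂ} (hψ : ψ.IsPrimitive) {f : K[X]} (hf : f.natDegree = d) :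
    ‖∑ x, ψ (f.eval x)‖ ≤ 2 * d * d.factorial * (Fintype.card K : ℝ) ^ (1 - 1 / (d : ℝ)) := by
  rcases hd.eq_or_lt with rfl | hd
  · obtain ⟨a, ha, b, rfl⟩ := natDegree_eq_one.mp hf
    have : ∑ x, ψ ((C a * X + C b).eval x) = 0 := by
      simp only [eval_add, eval_mul, eval_C, eval_X, AddChar.map_add_eq_mul, ← Finset.sum_mul]
      simp only [mul_comm a, AddChar.sum_mulShift a hψ, if_neg ha, Nat.cast_zero, zero_mul]
    rw [this, norm_zero]; positivity
  · have h := norm_sum_addChar_pow_le hd hK hψ hf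
    set Q : ℝ := (Fintype.card K : ℝ) with hQdef
    have hQ2 : 2 ≤ Q := by
      have : 1 < Fintype.card K := Fintype.one_lt_card
      rw [hQdef]; exact_mod_cast this
    have hQ : 0 < Q := by linarith
    set s := ‖∑ x, ψ (f.eval x)‖
    have hs : 0 ≤ s := norm_nonneg _
    have hD : (1 : ℝ) ≤ 2 * d * d.factorial := by
      have : 1 ≤ 2 * d * d.factorial := Nat.one_le_iff_ne_zero.mpr (by positivity)
      exact_mod_cast this
    have h1 : s ^ (2 * d) ≤ 2 * d * d.factorial * Q ^ (2 * d - 2) := by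
      have e1 : Q ^ (2 * d) = Q ^ (2 * d - 2) * Q ^ 2 := by rw [← pow_add]; congr 1; omega
      have e2 : Q ^ d * (d.factorial * Q ^ d) = d.factorial * (Q ^ (2 * d - 2) * Q ^ 2) := by
        rw [← e1]; ring
      rw [e2] at h
      -- Q - 1 ≥ Q/2 because a field has at least two elements; this is the source of the factor 2
      -- in the constant.
      have h3 : s ^ (2 * d) * (Q ^ 2 / 2) ≤ s ^ (2 * d) * (Q * (Q - 1)) := by
        gcongr; nlinarith
      have : 0 < Q ^ 2 := by positivity
      have h4 : s ^ (2 * d) * Q ^ 2 ≤ 2 * d * d.factorial * Q ^ (2 * d - 2) * Q ^ 2 := by linarith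
      exact le_of_mul_le_mul_right h4 this
    have h2 : s ^ (2 * d) ≤ (2 * d * d.factorial * Q ^ (1 - 1 / (d : ℝ))) ^ (2 * d) := by
      refine h1.trans ?_
      rw [mul_pow]
      have e3 : (Q ^ (1 - 1 / (d : ℝ))) ^ (2 * d) = Q ^ (2 * d - 2) := by
        rw [← Real.rpow_natCast, ← Real.rpow_mul hQ.le, ← Real.rpow_natCast]
        congr 1
        push_cast [Nat.cast_sub (show 2 ≤ 2 * d by omega)]
        have : (d : ℝ) ≠ 0 := by positivity
        field_simp
      rw [e3]
      gcongr
      exact le_self_pow₀ hD (by omega)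
    exact le_of_pow_le_pow_left₀ (by omega) (by positivity) h2
end

/-! ### Complete exponential sums and the prime modulus case -/

/-- The root of unity `exp (2 π i a / q)`. -/
noncomputable def rootExp (q : ℕ) (a : ℤ) : ℂ :=
  Complex.exp (2 * Real.pi * Complex.I * (a / q))

theorem rootExp_add (q : ℕ) (a b : ℤ) : rootExp q (a + b) = rootExp q a * rootExp q b := by
  rw [rootExp, rootExp, rootExp, ← Complex.exp_add]
  push_cast
  ring_nf

theorem rootExp_zero (q : ℕ) : rootExp q 0 = 1 := by simp [rootExp]

theorem norm_rootExp (q : ℕ) (a : ℤ) : ‖rootExp q a‖ = 1 := by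
  have : rootExp q a = Complex.exp (((2 * Real.pi * (a / q) : ℝ) : ℂ) * Complex.I) := by
    rw [rootExp]; push_cast; ring_nf
  rw [this, Complex.norm_exp_ofReal_mul_I]

theorem rootExp_eq_one_iff {q : ℕ} (hq : 0 < q) (a : ℤ) : rootExp q a = 1 ↔ (q : ℤ) ∣ a := by
  have hq' : (q : ℂ) ≠ 0 := by exact_mod_cast hq.ne'
  rw [rootExp, Complex.exp_eq_one_iff]
  have hpi : (2 * Real.pi * Complex.I : ℂ) ≠ 0 := Complex.two_pi_I_ne_zero
  constructor
  · rintro ⟨n, hn⟩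
    rw [mul_comm (n : ℂ)] at hn
    have h := mul_left_cancel₀ hpi hn
    rw [div_eq_iff hq'] at h
    exact ⟨n, by rw [mul_comm]; exact_mod_cast h⟩
  · rintro ⟨n, rfl⟩
    refine ⟨n, ?_⟩
    push_cast
    field_simp

theorem rootExp_mul_left {r : ℕ} (hr : 0 < r) (q : ℕ) (a : ℤ) :
    rootExp (r * q) (r * a) = rootExp q a := by
  have hr' : (r : ℂ) ≠ 0 := by exact_mod_cast hr.ne'
  rw [rootExp, rootExp]
  push_cast
  rw [mul_div_mul_left _ _ hr']

theorem rootExp_mul_nat (q : ℕ) (a : ℤ) (n : ℕ) : rootExp q (a * n) = rootExp q a ^ n := by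
  rw [rootExp, rootExp, ← Complex.exp_nat_mul]
  push_cast
  ring_nf

theorem rootExp_congr {q : ℕ} (hq : 0 < q) {a b : ℤ} (h : (q : ℤ) ∣ a - b) :
    rootExp q a = rootExp q b := by
  rw [show a = (a - b) + b by ring, rootExp_add, (rootExp_eq_one_iff hq _).mpr h, one_mul]

theorem rootExp_eq_stdAddChar (q : ℕ) [NeZero q] (a : ℤ) :
    rootExp q a = ZMod.stdAddChar (N := q) (a : ZMod q) := by
  rw [ZMod.stdAddChar_coe, rootExp]
  ring_nf

/-- The complete exponential sum of an integer polynomial modulo `q`. -/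
noncomputable def completeExpSum (q : ℕ) (f : ℤ[X]) : ℂ :=
  ∑ x ∈ Finset.range q, rootExp q (f.eval (x : ℤ))

theorem norm_sum_rootExp_le {ι : Type*} (s : Finset ι) (q : ℕ) (g : ι → ℤ) :
    ‖∑ x ∈ s, rootExp q (g x)‖ ≤ s.card := by
  refine (norm_sum_le _ _).trans ?_
  simp [norm_rootExp]

theorem sum_range_mul_eq {M : Type*} [AddCommMonoid M] (F : ℕ → M) (a b : ℕ) :
    ∑ x ∈ Finset.range (a * b), F x =
      ∑ y ∈ Finset.range a, ∑ z ∈ Finset.range b, F (y + a * z) := by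
  rw [Finset.sum_comm]
  induction b with
  | zero => simp
  | succ b ih =>
    rw [mul_add_one, Finset.sum_range_add, ih, Finset.sum_range_succ]
    simp only [add_comm]

theorem sum_range_eq_sum_zmod {q : ℕ} [NeZero q] {M : Type*} [AddCommMonoid M] (G : ZMod q → M) :
    ∑ x ∈ Finset.range q, G (x : ZMod q) = ∑ x : ZMod q, G x := by
  refine Finset.sum_bij' (fun x _ => (x : ZMod q)) (fun x _ => x.val) ?_ ?_ ?_ ?_ ?_
  · simp
  · intro a _; exact Finset.mem_range.mpr (ZMod.val_lt a)
  · intro a ha; exact ZMod.val_cast_of_lt (Finset.mem_range.mp ha)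
  · intro a _; simp
  · simp

theorem eval_map_intCast_zmod (q : ℕ) (f : ℤ[X]) (x : ℤ) :
    ((f.eval x : ℤ) : ZMod q) = (f.map (Int.castRingHom (ZMod q))).eval (x : ZMod q) := by
  rw [← eq_intCast (Int.castRingHom (ZMod q)) x, eval_map_apply]
  simp

theorem completeExpSum_eq_sum_zmod (q : ℕ) [NeZero q] (f : ℤ[X]) :
    completeExpSum q f =
      ∑ x : ZMod q, ZMod.stdAddChar ((f.map (Int.castRingHom (ZMod q))).eval x) := by
  rw [← sum_range_eq_sum_zmod, completeExpSum]
  refine Finset.sum_congr rfl fun x _ => ?_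
  rw [rootExp_eq_stdAddChar, eval_map_intCast_zmod]
  simp

theorem norm_completeExpSum_le (q : ℕ) (f : ℤ[X]) : ‖completeExpSum q f‖ ≤ q := by
  simpa [completeExpSum] using norm_sum_rootExp_le (Finset.range q) q (fun x => f.eval (x : ℤ))

/-- If p exceeds the degree e of the reduction, Mordell's bound applies with e ≤ k. Otherwise p ≤ k
and the trivial bound suffices. The summand k^3 is more than needed here; it makes the constant the
one used for prime powers. -/
theorem norm_completeExpSum_prime_le {p : ℕ} [Fact p.Prime] {k : ℕ} {f : ℤ[X]}
    (hfk : f.natDegree ≤ k) (hf : 1 ≤ (f.map (Int.castRingHom (ZMod p))).natDegree) :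
    ‖completeExpSum p f‖ ≤ (2 * k * k.factorial + k ^ 3) * (p : ℝ) ^ (1 - 1 / (k : ℝ)) := by
  obtain ⟨e, he⟩ : ∃ e, (f.map (Int.castRingHom (ZMod p))).natDegree = e := ⟨_, rfl⟩
  rw [he] at hf
  have hek : e ≤ k := he ▸ natDegree_map_le.trans hfk
  have hp1 : (1 : ℝ) ≤ p := by exact_mod_cast (Fact.out : p.Prime).one_lt.le
  have hk0 : (0 : ℝ) < k := by exact_mod_cast (by omega : 0 < k)
  have hexp : 0 ≤ 1 - 1 / (k : ℝ) := by
    rw [sub_nonneg, div_le_one hk0]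
    exact_mod_cast (by omega : 1 ≤ k)
  rcases lt_or_ge e p with hep | hep
  · rw [completeExpSum_eq_sum_zmod]
    refine (norm_sum_addChar_le hf (fun j h1 h2 h0 => ?_) (ZMod.isPrimitive_stdAddChar p)
      he).trans ?_
    · have := Nat.le_of_dvd (by omega) ((ZMod.natCast_eq_zero_iff j p).mp h0)
      omega
    · rw [ZMod.card]
      have h1 : (2 * e * e.factorial : ℝ) ≤ 2 * k * k.factorial := by
        have := Nat.factorial_le hek
        gcongr
      have h2 : (p : ℝ) ^ (1 - 1 / (e : ℝ)) ≤ (p : ℝ) ^ (1 - 1 / (k : ℝ)) := by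
        apply Real.rpow_le_rpow_of_exponent_le hp1
        have : (0 : ℝ) < e := by exact_mod_cast (by omega : 0 < e)
        gcongr
      have h3 : (0 : ℝ) ≤ (k : ℝ) ^ 3 := by positivity
      gcongr
      linarith
  · refine (norm_completeExpSum_le p f).trans ?_
    have h1 : (p : ℝ) ≤ k := by exact_mod_cast hep.trans hek
    have h2 : (1 : ℝ) ≤ (p : ℝ) ^ (1 - 1 / (k : ℝ)) := Real.one_le_rpow hp1 hexp
    have h3 : (k : ℝ) ≤ 2 * k * k.factorial + k ^ 3 := by
      have : (k : ℝ) ≤ k ^ 3 := le_self_pow₀ (by linarith) (by norm_num)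
      have : (0 : ℝ) ≤ 2 * k * k.factorial := by positivity
      linarith
    calc (p : ℝ) ≤ (2 * k * k.factorial + k ^ 3) * 1 := by linarith
      _ ≤ _ := by gcongr

/-! ### Prime power moduli: critical points and local expansion -/

theorem int_map_zmod_coeff_eq_zero_iff {p : ℕ} (f : ℤ[X]) (j : ℕ) :
    (f.map (Int.castRingHom (ZMod p))).coeff j = 0 ↔ (p : ℤ) ∣ f.coeff j := by
  rw [coeff_map, eq_intCast, ZMod.intCast_zmod_eq_zero_iff_dvd]

theorem exists_eq_C_pow_mul_map_ne_zero {p : ℕ} (hp : p.Prime) {g : ℤ[X]} (hg : g ≠ 0) :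
    ∃ (n : ℕ) (h : ℤ[X]), g = C ((p : ℤ) ^ n) * h ∧ h.map (Int.castRingHom (ZMod p)) ≠ 0 := by
  have hprime : Prime (C (p : ℤ)) := prime_C_iff.mpr (Nat.prime_iff_prime_int.mp hp)
  obtain ⟨n, h, hn, hgh⟩ := WfDvdMonoid.max_power_factor hg hprime.irreducible
  refine ⟨n, h, by rw [hgh, C_pow], fun h0 => hn ?_⟩
  rw [C_dvd_iff_dvd_coeff]
  intro j
  rw [← int_map_zmod_coeff_eq_zero_iff, h0, coeff_zero]

/-- A p-adic stationary phase: moving x by p^(l-τ-1) z changes f(x) modulo p^l by p^(l-1) z F(x), so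
the average over z vanishes unless p divides F(x). -/
theorem completeExpSum_eq_sum_critical {p : ℕ} (hp : p.Prime) {l τ : ℕ} (hl : 2 * τ + 2 ≤ l)
    {f F : ℤ[X]} (hF : derivative f = C ((p : ℤ) ^ τ) * F) :
    completeExpSum (p ^ l) f =
      ∑ ξ ∈ Finset.range p with (p : ℤ) ∣ F.eval ((ξ : ℕ) : ℤ),
        ∑ y ∈ Finset.range (p ^ (l - 1)), rootExp (p ^ l) (f.eval ((ξ : ℤ) + p * y)) := by
  classical
  have hp0 := hp.pos
  have hper : ∀ (y : ℤ) (w : ℤ), ((p : ℤ) ∣ F.eval (y + p * w)) ↔ (p : ℤ) ∣ F.eval y := by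
    intro y w
    have h := F.sub_dvd_eval_sub (y + p * w) y
    have h2 : (p : ℤ) ∣ F.eval (y + p * w) - F.eval y := (Dvd.intro w (by ring)).trans h
    exact (dvd_iff_dvd_of_dvd_sub h2)
  have hsplit : completeExpSum (p ^ l) f =
      ∑ x ∈ Finset.range (p ^ l), (if (p : ℤ) ∣ F.eval ((x : ℕ) : ℤ) then
        rootExp (p ^ l) (f.eval ((x : ℕ) : ℤ)) else 0) +
      ∑ x ∈ Finset.range (p ^ l), (if (p : ℤ) ∣ F.eval ((x : ℕ) : ℤ) then 0 else
        rootExp (p ^ l) (f.eval ((x : ℕ) : ℤ))) := by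
    rw [← Finset.sum_add_distrib, completeExpSum]
    refine Finset.sum_congr rfl fun x _ => ?_
    split_ifs <;> simp
  have hzero : ∑ x ∈ Finset.range (p ^ l), (if (p : ℤ) ∣ F.eval ((x : ℕ) : ℤ) then 0 else
        rootExp (p ^ l) (f.eval ((x : ℕ) : ℤ))) = 0 := by
    have e1 : p ^ l = p ^ (l - τ - 1) * p ^ (τ + 1) := by rw [← pow_add]; congr 1; omega
    rw [e1, sum_range_mul_eq, ← e1]
    refine Finset.sum_eq_zero fun y _ => ?_
    have h1 : ∀ z : ℕ, (((y + p ^ (l - τ - 1) * z : ℕ) : ℕ) : ℤ) =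
        (y : ℤ) + p * ((p : ℤ) ^ (l - τ - 2) * z) := by
      intro z
      push_cast
      rw [← mul_assoc, ← pow_succ', show l - τ - 2 + 1 = l - τ - 1 by omega]
    by_cases hy : (p : ℤ) ∣ F.eval ((y : ℕ) : ℤ)
    · refine Finset.sum_eq_zero fun z _ => ?_
      rw [h1, if_pos ((hper _ _).mpr hy)]
    · have h2 : ∀ z : ℕ, rootExp (p ^ l) (f.eval (((y + p ^ (l - τ - 1) * z : ℕ) : ℕ) : ℤ)) =
          rootExp (p ^ l) (f.eval (y : ℤ)) * rootExp p (F.eval (y : ℤ)) ^ z := by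
        intro z
        obtain ⟨c, hc⟩ := f.binomExpansion (y : ℤ) ((p : ℤ) ^ (l - τ - 1) * z)
        rw [← rootExp_mul_nat, ← rootExp_mul_left (r := p ^ (l - 1)) (by positivity) p,
          ← pow_succ, show l - 1 + 1 = l by omega, ← rootExp_add]
        apply rootExp_congr (by positivity)
        push_cast
        rw [hc, hF]
        have e2 : (p : ℤ) ^ (l - 1) = p ^ τ * p ^ (l - τ - 1) := by
          rw [← pow_add]; congr 1; omega
        -- The second-order term disappears modulo p^l exactly because 2(l - τ - 1) ≥ l, which is
        -- `hl`.
        have e3 : ((p : ℤ) ^ (l - τ - 1) * z) ^ 2 = p ^ l * (p ^ (l - 2 * τ - 2) * z ^ 2) := by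
          rw [mul_pow, ← mul_assoc, ← pow_add, ← pow_mul]; congr 2; omega
        rw [e2, e3, eval_mul, eval_C]
        exact ⟨c * (p ^ (l - 2 * τ - 2) * z ^ 2), by ring⟩
      have h3 : ∀ z ∈ Finset.range (p ^ (τ + 1)),
          (if (p : ℤ) ∣ F.eval (((y + p ^ (l - τ - 1) * z : ℕ) : ℕ) : ℤ) then 0 else
            rootExp (p ^ l) (f.eval (((y + p ^ (l - τ - 1) * z : ℕ) : ℕ) : ℤ))) =
          rootExp (p ^ l) (f.eval (y : ℤ)) * rootExp p (F.eval (y : ℤ)) ^ z := by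
        intro z _
        rw [if_neg, h2]
        rw [h1, hper]; exact hy
      rw [Finset.sum_congr rfl h3, ← Finset.mul_sum]
      have hne : rootExp p (F.eval (y : ℤ)) ≠ 1 := fun h => hy ((rootExp_eq_one_iff hp0 _).mp h)
      rw [geom_sum_eq hne, ← rootExp_mul_nat, (rootExp_eq_one_iff hp0 _).mpr]
      · simp
      · push_cast
        rw [pow_succ]
        exact ⟨F.eval (y : ℤ) * p ^ τ, by ring⟩
  rw [hsplit, hzero, add_zero]
  have e1 : p ^ l = p * p ^ (l - 1) := by rw [← pow_succ']; congr 1; omega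
  conv_lhs => rw [show Finset.range (p ^ l) = Finset.range (p * p ^ (l - 1)) by rw [e1]]
  rw [sum_range_mul_eq, Finset.sum_filter]
  refine Finset.sum_congr rfl fun y _ => ?_
  push_cast
  simp only [hper]
  split_ifs <;> simp

/-- Here p^σ is the exact power of p dividing f(ξ + pX) - f(ξ). Differentiating gives p^(σ+τ') F' =
p^(τ+1) F(ξ + pX), where the j-th coefficient of F(ξ + pX) carries p^j. This forces the reduction of
F' to have degree at most the multiplicity of ξ as a zero of F, so degrees summed over critical
points do not grow. -/
theorem exists_local_expansion {p : ℕ} [hp : Fact p.Prime] {k τ : ℕ} {f F : ℤ[X]}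
    (hfk : f.natDegree ≤ k) (hf : 1 ≤ (f.map (Int.castRingHom (ZMod p))).natDegree)
    (hF : derivative f = C ((p : ℤ) ^ τ) * F) (hF0 : F.map (Int.castRingHom (ZMod p)) ≠ 0)
    (ξ : ℤ) :
    ∃ (σ τ' : ℕ) (h F' : ℤ[X]), 1 ≤ σ ∧ σ ≤ k ∧ h.natDegree ≤ k ∧
      (∀ y, f.eval (ξ + p * y) = f.eval ξ + p ^ σ * h.eval y) ∧
      1 ≤ (h.map (Int.castRingHom (ZMod p))).natDegree ∧
      derivative h = C ((p : ℤ) ^ τ') * F' ∧ F'.map (Int.castRingHom (ZMod p)) ≠ 0 ∧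
      (F'.map (Int.castRingHom (ZMod p))).natDegree ≤
        (F.map (Int.castRingHom (ZMod p))).rootMultiplicity (ξ : ZMod p) := by
  set φ := Int.castRingHom (ZMod p) with hφ
  have hpp : Prime (p : ℤ) := Nat.prime_iff_prime_int.mp hp.out
  have hp0 : (p : ℤ) ≠ 0 := hpp.ne_zero
  set u := taylor ξ f with hu
  have hcomp : ∀ w : ℤ[X], ∀ j, (w.comp (C (p : ℤ) * X)).coeff j = w.coeff j * p ^ j :=
    fun w j => comp_C_mul_X_coeff
  set j0 := (u.map φ).natDegree with hj0
  have hj0' : j0 = (f.map φ).natDegree := by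
    rw [hj0, hu, map_taylor, natDegree_taylor]
  have hj0k : j0 ≤ k := hj0' ▸ natDegree_map_le.trans hfk
  have hu0 : ¬ (p : ℤ) ∣ u.coeff j0 := by
    rw [← int_map_zmod_coeff_eq_zero_iff]
    exact leadingCoeff_ne_zero.mpr (fun h0 => by rw [h0] at hj0; simp at hj0; omega)
  set g1 := u.comp (C (p : ℤ) * X) - C (f.eval ξ) with hg1
  have hg1c : ∀ j, 1 ≤ j → g1.coeff j = u.coeff j * p ^ j := by
    intro j hj
    rw [hg1, coeff_sub, hcomp, coeff_C, if_neg (by omega), sub_zero]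
  have hg10 : g1.coeff 0 = 0 := by
    rw [hg1, coeff_sub, hcomp, hu, taylor_coeff_zero]; simp
  have hg1ne : g1 ≠ 0 := by
    intro h0
    have := hg1c j0 (by omega)
    rw [h0, coeff_zero] at this
    rcases mul_eq_zero.mp this.symm with h | h
    · exact hu0 (h ▸ dvd_zero _)
    · exact pow_ne_zero _ hp0 h
  obtain ⟨σ, h, hgh, hh0⟩ := exists_eq_C_pow_mul_map_ne_zero hp.out hg1ne
  have hgc : ∀ j, g1.coeff j = p ^ σ * h.coeff j := fun j => by rw [hgh, coeff_C_mul]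
  have hhc0 : h.coeff 0 = 0 := by
    have := hgc 0
    rw [hg10] at this
    exact (mul_eq_zero.mp this.symm).resolve_left (pow_ne_zero _ hp0)
  -- h has zero constant term, so a nonzero reduction is nonconstant.
  have hh1 : 1 ≤ (h.map φ).natDegree := by
    by_contra hlt
    have h1 := eq_C_of_natDegree_eq_zero (show (h.map φ).natDegree = 0 by omega)
    rw [coeff_map, hhc0, map_zero, C_0] at h1
    exact hh0 h1
  have hhne : derivative h ≠ 0 := by
    intro h0
    have h1 := derivative_eq_zero.mp h0
    have h2 : (h.map φ).natDegree ≤ h.natDegree := natDegree_map_le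
    omega
  obtain ⟨τ', F', hF', hF'0⟩ := exists_eq_C_pow_mul_map_ne_zero hp.out hhne
  have heval : ∀ y, f.eval (ξ + p * y) = f.eval ξ + p ^ σ * h.eval y := by
    intro y
    have h1 : g1.eval y = f.eval (ξ + p * y) - f.eval ξ := by
      rw [hg1, hu, eval_sub, eval_comp, taylor_eval]; simp [add_comm]
    rw [hgh, eval_mul, eval_C] at h1
    linarith
  refine ⟨σ, τ', h, F', ?_, ?_, ?_, heval, hh1, hF', hF'0, ?_⟩
  · by_contra hσ
    apply hh0
    ext j
    rw [coeff_zero, int_map_zmod_coeff_eq_zero_iff]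
    have h1 := hgc j
    rw [show σ = 0 by omega, pow_zero, one_mul] at h1
    rw [← h1]
    rcases Nat.eq_zero_or_pos j with rfl | hj
    · rw [hg10]; exact dvd_zero _
    · rw [hg1c j hj]
      exact Dvd.dvd.mul_left (dvd_pow_self _ (by omega)) _
  · refine le_trans ?_ hj0k
    have h1 : (p : ℤ) ^ σ ∣ p ^ j0 * u.coeff j0 := by
      rw [mul_comm, ← hg1c j0 (by omega), hgc]; exact dvd_mul_right _ _
    by_contra hlt
    have h2 : (p : ℤ) ^ (j0 + 1) ∣ p ^ j0 * u.coeff j0 := (pow_dvd_pow _ (by omega)).trans h1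
    rw [pow_succ] at h2
    exact hu0 ((mul_dvd_mul_iff_left (pow_ne_zero _ hp0)).mp h2)
  · have h1 : h.natDegree = g1.natDegree := by
      rw [hgh, natDegree_C_mul (pow_ne_zero _ hp0)]
    rw [h1, hg1, natDegree_sub_C]
    refine natDegree_comp_le.trans ?_
    have h2 : (C (p : ℤ) * X).natDegree ≤ 1 := by
      rw [natDegree_C_mul hp0, natDegree_X]
    calc u.natDegree * (C (p : ℤ) * X).natDegree ≤ u.natDegree * 1 := by gcongr
      _ ≤ k := by rw [mul_one, hu, natDegree_taylor]; exact hfk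
  · have hder : C ((p : ℤ) ^ (σ + τ')) * F' = C ((p : ℤ) ^ (τ + 1)) *
        (taylor ξ F).comp (C (p : ℤ) * X) := by
      have h1 : derivative g1 = C (p : ℤ) * (C ((p : ℤ) ^ τ) * (taylor ξ F).comp (C (p : ℤ) * X)) := by
        rw [hg1, hu, derivative_sub, derivative_C, sub_zero, derivative_comp, taylor_apply,
          derivative_comp, hF]
        simp [taylor_apply, mul_comp]
      have h2 : derivative g1 = C ((p : ℤ) ^ σ) * (C ((p : ℤ) ^ τ') * F') := by
        rw [hgh, derivative_C_mul, hF']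
      rw [pow_add, pow_succ', C_mul, C_mul, mul_assoc, mul_assoc, ← h2, h1]
    set n := (F.map φ).rootMultiplicity (ξ : ZMod p) with hn
    have hc : ∀ j, (p : ℤ) ^ (σ + τ') * F'.coeff j = p ^ (τ + 1 + j) * (taylor ξ F).coeff j := by
      intro j
      have := congrArg (fun w => w.coeff j) hder
      simp only [coeff_C_mul, hcomp] at this
      rw [this, pow_add]; ring
    have hbn : ¬ (p : ℤ) ∣ (taylor ξ F).coeff n := by
      rw [← int_map_zmod_coeff_eq_zero_iff, map_taylor, hn, rootMultiplicity_eq_natTrailingDegree,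
        eq_intCast, ← taylor_apply]
      apply trailingCoeff_nonzero_iff_nonzero.mpr
      rwa [Ne, taylor_eq_zero]
    -- n is the lowest degree at which the Taylor expansion of F at ξ has a coefficient prime to p;
    -- comparing that coefficient bounds σ + τ'. For j > n the right side of `hc` then has a spare
    -- factor p.
    have hN : σ + τ' ≤ τ + 1 + n := by
      by_contra hlt
      have h1 : (p : ℤ) ^ (τ + 1 + n + 1) ∣ p ^ (τ + 1 + n) * (taylor ξ F).coeff n := by
        rw [← hc n]
        exact (pow_dvd_pow _ (by omega)).mul_right _
      rw [pow_succ] at h1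
      exact hbn ((mul_dvd_mul_iff_left (pow_ne_zero _ hp0)).mp h1)
    rw [natDegree_le_iff_coeff_eq_zero]
    intro j hj
    rw [int_map_zmod_coeff_eq_zero_iff]
    have h1 : (p : ℤ) ^ (σ + τ') * p ∣ p ^ (σ + τ') * F'.coeff j := by
      rw [hc j, ← pow_succ]
      exact (pow_dvd_pow _ (by omega)).mul_right _
    exact (mul_dvd_mul_iff_left (pow_ne_zero _ hp0)).mp h1

theorem sum_rootMultiplicity_range_le {p : ℕ} [Fact p.Prime] {F : ℤ[X]}
    (hF0 : F.map (Int.castRingHom (ZMod p)) ≠ 0) :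
    ∑ ξ ∈ Finset.range p with (p : ℤ) ∣ F.eval ((ξ : ℕ) : ℤ),
      (F.map (Int.castRingHom (ZMod p))).rootMultiplicity (ξ : ZMod p) ≤
        (F.map (Int.castRingHom (ZMod p))).natDegree := by
  classical
  set G := F.map (Int.castRingHom (ZMod p))
  refine le_trans ?_ (card_roots' G)
  rw [← Multiset.toFinset_sum_count_eq,
    ← Finset.sum_image (f := fun a => G.rootMultiplicity a) (g := fun ξ : ℕ => (ξ : ZMod p))]
  · simp only [count_roots]
    apply Finset.sum_le_sum_of_subset
    intro a ha
    obtain ⟨ξ, hξ, rfl⟩ := Finset.mem_image.mp ha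
    rw [Multiset.mem_toFinset, mem_roots hF0, IsRoot.def]
    have h1 := (Finset.mem_filter.mp hξ).2
    rw [← ZMod.intCast_zmod_eq_zero_iff_dvd, eval_map_intCast_zmod] at h1
    rwa [Int.cast_natCast] at h1
  · intro a ha b hb hab
    have ha' := Finset.mem_range.mp (Finset.mem_filter.mp ha).1
    have hb' := Finset.mem_range.mp (Finset.mem_filter.mp hb).1
    have := congrArg ZMod.val hab
    simpa [ZMod.val_cast_of_lt ha', ZMod.val_cast_of_lt hb'] using this

/-- Strong induction on l. The bound is linear in m, which dominates the degree of F modulo p: each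
critical point takes over its multiplicity as the new m, and these multiplicities add up to at most
m. Thus the constant never deteriorates under recursion. -/
theorem norm_completeExpSum_prime_pow_aux {p : ℕ} [hp : Fact p.Prime] {k : ℕ} (l : ℕ) :
    ∀ (f F : ℤ[X]) (τ m : ℕ), 1 ≤ l → f.natDegree ≤ k →
      1 ≤ (f.map (Int.castRingHom (ZMod p))).natDegree →
      derivative f = C ((p : ℤ) ^ τ) * F → F.map (Int.castRingHom (ZMod p)) ≠ 0 →
      (F.map (Int.castRingHom (ZMod p))).natDegree ≤ m → 1 ≤ m →
      ‖completeExpSum (p ^ l) f‖ ≤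
        (2 * k * k.factorial + k ^ 3) * m * (p : ℝ) ^ (l * (1 - 1 / (k : ℝ))) := by
  induction l using Nat.strong_induction_on with
  | _ l ih =>
  intro f F τ m hl hfk hf hF hF0 hm hm1
  have hfd : (f.map (Int.castRingHom (ZMod p))).natDegree ≤ f.natDegree := natDegree_map_le
  have hk : 1 ≤ k := by omega
  have hkR : (1 : ℝ) ≤ k := by exact_mod_cast hk
  have hp1 : (1 : ℝ) ≤ p := by exact_mod_cast hp.out.one_lt.le
  have hp0 : (0 : ℝ) < p := by linarith
  have hmR : (1 : ℝ) ≤ m := by exact_mod_cast hm1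
  have hθ : 0 ≤ 1 - 1 / (k : ℝ) := by
    rw [sub_nonneg, div_le_one (by linarith)]; exact hkR
  have hA0 : (0 : ℝ) ≤ 2 * k * k.factorial := by positivity
  have hk3 : (1 : ℝ) ≤ (k : ℝ) ^ 3 := one_le_pow₀ hkR
  set A : ℝ := 2 * k * k.factorial + k ^ 3 with hA
  have hA1 : 1 ≤ A := by linarith
  have hrp : ∀ n : ℕ, (1 : ℝ) ≤ (p : ℝ) ^ (n * (1 - 1 / (k : ℝ))) := fun n =>
    Real.one_le_rpow hp1 (by positivity)
  rcases hl.eq_or_lt with rfl | hl1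
  · rw [pow_one]
    refine (norm_completeExpSum_prime_le hfk hf).trans ?_
    rw [Nat.cast_one, one_mul]
    gcongr
    exact le_mul_of_one_le_right (by linarith) hmR
  rcases Nat.lt_or_ge l (2 * τ + 2) with hlτ | hlτ
  -- With 2 ≤ l ≤ 2τ + 1 the critical point argument is unavailable, but p^τ divides j f_j with f_j
  -- prime to p, so p^τ ≤ k. As l ≤ 3τ, the whole modulus is at most k^3.
  · have hτ : 1 ≤ τ := by omega
    obtain ⟨j, hj⟩ : ∃ j, (f.map (Int.castRingHom (ZMod p))).natDegree = j := ⟨_, rfl⟩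
    have hpj : p ^ τ ≤ k := by
      have h1 : ¬ (p : ℤ) ∣ f.coeff j := by
        rw [← int_map_zmod_coeff_eq_zero_iff, ← hj]
        exact leadingCoeff_ne_zero.mpr (fun h0 => by rw [h0] at hf; simp at hf)
      have h2 := congrArg (fun w => w.coeff (j - 1)) hF
      simp only [coeff_derivative, coeff_C_mul] at h2
      rw [show j - 1 + 1 = j by omega, show (((j - 1 : ℕ) : ℤ) + 1) = j by omega] at h2
      have h3 : ((p : ℤ) ^ τ) ∣ f.coeff j * j := h2 ▸ dvd_mul_right _ _
      have h4 : IsCoprime ((p : ℤ) ^ τ) (f.coeff j) :=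
        IsCoprime.pow_left ((Nat.prime_iff_prime_int.mp hp.out).coprime_iff_not_dvd.mpr h1)
      have h5 : p ^ τ ∣ j := by exact_mod_cast h4.dvd_of_dvd_mul_left h3
      exact (Nat.le_of_dvd (by omega) h5).trans (by omega)
    have h1 : ((p ^ l : ℕ) : ℝ) ≤ (k : ℝ) ^ 3 := by
      have : p ^ l ≤ k ^ 3 := calc
        p ^ l ≤ p ^ (τ * 3) := Nat.pow_le_pow_right hp.out.pos (by omega)
        _ = (p ^ τ) ^ 3 := pow_mul _ _ _
        _ ≤ k ^ 3 := by gcongr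
      exact_mod_cast this
    calc _ ≤ ((p ^ l : ℕ) : ℝ) := norm_completeExpSum_le _ _
      _ ≤ A * 1 * 1 := by linarith
      _ ≤ _ := by
        have := hrp l
        gcongr
  rw [completeExpSum_eq_sum_critical hp.out hlτ hF]
  refine (norm_sum_le _ _).trans ?_
  have key : ∀ ξ ∈ (Finset.range p).filter (fun ξ : ℕ => (p : ℤ) ∣ F.eval ((ξ : ℕ) : ℤ)),
      ‖∑ y ∈ Finset.range (p ^ (l - 1)), rootExp (p ^ l) (f.eval ((ξ : ℤ) + p * y))‖ ≤
      A * (p : ℝ) ^ (l * (1 - 1 / (k : ℝ))) *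
        ((F.map (Int.castRingHom (ZMod p))).rootMultiplicity (ξ : ZMod p) : ℕ) := by
    intro ξ hξ
    obtain ⟨σ, τ', h, F', hσ1, hσk, hhk, heval, hh1, hF', hF'0, hdeg⟩ :=
      exists_local_expansion hfk hf hF hF0 (ξ : ℤ)
    rw [Int.cast_natCast] at hdeg
    set n := (F.map (Int.castRingHom (ZMod p))).rootMultiplicity (ξ : ZMod p)
    have hn : 1 ≤ n := by
      have h1 := (Finset.mem_filter.mp hξ).2
      rw [← ZMod.intCast_zmod_eq_zero_iff_dvd, eval_map_intCast_zmod, Int.cast_natCast] at h1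
      exact (rootMultiplicity_pos hF0).mpr h1
    have hnR : (1 : ℝ) ≤ n := by exact_mod_cast hn
    rcases Nat.lt_or_ge σ l with hσl | hσl
    -- The inner sum runs over p^(σ-1) full periods of h modulo p^(l-σ). The exponent balance (σ -
    -- 1) + (l - σ)(1 - 1/k) ≤ l(1 - 1/k) is σ ≤ k.
    · have h1 : ∑ y ∈ Finset.range (p ^ (l - 1)), rootExp (p ^ l) (f.eval ((ξ : ℤ) + p * y)) =
          rootExp (p ^ l) (f.eval (ξ : ℤ)) * (p ^ (σ - 1) * completeExpSum (p ^ (l - σ)) h) := by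
        have e1 : p ^ (l - 1) = p ^ (l - σ) * p ^ (σ - 1) := by rw [← pow_add]; congr 1; omega
        have e2 : p ^ l = p ^ σ * p ^ (l - σ) := by rw [← pow_add]; congr 1; omega
        have e3 : ∀ y : ℤ, rootExp (p ^ l) (f.eval ((ξ : ℤ) + p * y)) =
            rootExp (p ^ l) (f.eval (ξ : ℤ)) * rootExp (p ^ (l - σ)) (h.eval y) := by
          intro y
          rw [heval, rootExp_add]
          congr 1
          have e4 := rootExp_mul_left (r := p ^ σ) (pow_pos hp.out.pos _) (p ^ (l - σ)) (h.eval y)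
          rw [e2]
          exact_mod_cast e4
        simp only [e3]
        rw [← Finset.mul_sum, e1, sum_range_mul_eq, completeExpSum]
        congr 1
        rw [Finset.mul_sum]
        refine Finset.sum_congr rfl fun y _ => ?_
        rw [Finset.sum_congr rfl (g := fun _ => rootExp (p ^ (l - σ)) (h.eval (y : ℤ)))]
        · simp
        · intro z _
          apply rootExp_congr (pow_pos hp.out.pos _)
          refine dvd_trans ?_ (h.sub_dvd_eval_sub _ _)
          push_cast
          exact ⟨z, by ring⟩
      have h2 := ih (l - σ) (by omega) h F' τ' n (by omega) hhk hh1 hF' hF'0 hdeg hn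
      rw [h1, norm_mul, norm_rootExp, one_mul, norm_mul, norm_pow, Complex.norm_natCast]
      calc (p : ℝ) ^ (σ - 1) * ‖completeExpSum (p ^ (l - σ)) h‖
          ≤ (p : ℝ) ^ (σ - 1) * (A * n * (p : ℝ) ^ ((l - σ : ℕ) * (1 - 1 / (k : ℝ)))) := by
            gcongr
        _ = A * ((p : ℝ) ^ (σ - 1) * (p : ℝ) ^ ((l - σ : ℕ) * (1 - 1 / (k : ℝ)))) * n := by ring
        _ ≤ _ := by
            gcongr
            rw [← Real.rpow_natCast, ← Real.rpow_add hp0]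
            apply Real.rpow_le_rpow_of_exponent_le hp1
            rw [Nat.cast_sub hσ1, Nat.cast_sub hσl.le]
            have : (σ : ℝ) / k ≤ 1 := (div_le_one (by linarith)).mpr (by exact_mod_cast hσk)
            have e : (σ : ℝ) * (1 / k) = σ / k := by ring
            push_cast
            linarith
    -- Here l ≤ σ ≤ k, so the trivial bound p^(l-1) is already at most p^(l(1-1/k)).
    · have h1 := norm_sum_rootExp_le (Finset.range (p ^ (l - 1))) (p ^ l)
        (fun y : ℕ => f.eval ((ξ : ℤ) + p * y))
      refine h1.trans ?_
      rw [Finset.card_range]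
      calc ((p ^ (l - 1) : ℕ) : ℝ) = (p : ℝ) ^ ((l - 1 : ℕ) : ℝ) := by
            rw [Real.rpow_natCast]; push_cast; rfl
        _ ≤ 1 * (p : ℝ) ^ (l * (1 - 1 / (k : ℝ))) * 1 := by
            rw [one_mul, mul_one]
            apply Real.rpow_le_rpow_of_exponent_le hp1
            rw [Nat.cast_sub hl]
            have : (l : ℝ) / k ≤ 1 :=
              (div_le_one (by linarith)).mpr (by exact_mod_cast hσl.trans hσk)
            have e : (l : ℝ) * (1 / k) = l / k := by ring
            push_cast
            linarith
        _ ≤ _ := by gcongr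
  refine (Finset.sum_le_sum key).trans ?_
  rw [← Finset.mul_sum, ← Nat.cast_sum]
  have h1 := (sum_rootMultiplicity_range_le hF0).trans hm
  calc _ ≤ A * (p : ℝ) ^ (l * (1 - 1 / (k : ℝ))) * (m : ℝ) := by gcongr
    _ = _ := by ring

theorem norm_completeExpSum_prime_pow_le {p : ℕ} [hp : Fact p.Prime] {k l : ℕ} (hl : 1 ≤ l)
    {f : ℤ[X]} (hfk : f.natDegree ≤ k) (hf : 1 ≤ (f.map (Int.castRingHom (ZMod p))).natDegree) :
    ‖completeExpSum (p ^ l) f‖ ≤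
      (2 * k * k.factorial + k ^ 3) * k * ((p ^ l : ℕ) : ℝ) ^ (1 - 1 / (k : ℝ)) := by
  have hfd : (f.map (Int.castRingHom (ZMod p))).natDegree ≤ f.natDegree := natDegree_map_le
  have hne : derivative f ≠ 0 := by
    intro h0
    have h1 := derivative_eq_zero.mp h0
    omega
  obtain ⟨τ, F, hF, hF0⟩ := exists_eq_C_pow_mul_map_ne_zero hp.out hne
  have h1 := norm_completeExpSum_prime_pow_aux l f F τ k hl hfk hf hF hF0 ?_ (by omega)
  · rw [Real.rpow_mul (by positivity), Real.rpow_natCast] at h1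
    exact_mod_cast h1
  · refine natDegree_map_le.trans ?_
    have h2 : F.natDegree = (derivative f).natDegree := by
      rw [hF, natDegree_C_mul (pow_ne_zero _ (by exact_mod_cast hp.out.ne_zero))]
    rw [h2]
    exact (natDegree_derivative_le f).trans (by omega)

/-! ### Multiplicativity and general moduli -/

theorem sum_range_mul_coprime {a b : ℕ} [NeZero a] [NeZero b] (hab : a.Coprime b)
    (g : ZMod a → ℂ) (h : ZMod b → ℂ) :
    ∑ x ∈ Finset.range (a * b), g (x : ZMod a) * h (x : ZMod b) = (∑ x, g x) * ∑ x, h x := by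
  have h1 := sum_range_eq_sum_zmod (q := a * b) (fun x =>
    g (ZMod.chineseRemainder hab x).1 * h (ZMod.chineseRemainder hab x).2)
  simp only [map_natCast, Prod.fst_natCast, Prod.snd_natCast] at h1
  rw [h1, Fintype.sum_mul_sum, ← Fintype.sum_prod_type']
  exact Fintype.sum_equiv (ZMod.chineseRemainder hab).toEquiv _ _ (fun x => rfl)

/-- The Bézout relation says 1/(ab) = u/a + v/b, which factors each term; the Chinese remainder
theorem factors the sum. -/
theorem completeExpSum_mul_coprime {a b : ℕ} (ha : 0 < a) (hb : 0 < b) {u v : ℤ}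
    (huv : u * b + v * a = 1) (f : ℤ[X]) :
    completeExpSum (a * b) f = completeExpSum a (C u * f) * completeExpSum b (C v * f) := by
  have : NeZero a := ⟨ha.ne'⟩
  have : NeZero b := ⟨hb.ne'⟩
  have hab : a.Coprime b := by
    rw [← Nat.isCoprime_iff_coprime]
    exact ⟨v, u, by linarith⟩
  rw [completeExpSum_eq_sum_zmod a, completeExpSum_eq_sum_zmod b, ← sum_range_mul_coprime hab,
    completeExpSum]
  refine Finset.sum_congr rfl fun x _ => ?_
  rw [← Int.cast_natCast (R := ZMod a), ← Int.cast_natCast (R := ZMod b), ← eval_map_intCast_zmod,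
    ← eval_map_intCast_zmod, ← rootExp_eq_stdAddChar, ← rootExp_eq_stdAddChar,
    ← rootExp_mul_left hb a, ← rootExp_mul_left ha b, mul_comm b a, ← rootExp_add]
  congr 1
  rw [eval_mul, eval_mul, eval_C, eval_C]
  linear_combination (-f.eval (x : ℤ)) * huv

theorem natDegree_map_C_mul_zmod {p : ℕ} [Fact p.Prime] {u : ℤ} (hu : ¬ (p : ℤ) ∣ u) (f : ℤ[X]) :
    ((C u * f).map (Int.castRingHom (ZMod p))).natDegree =
      (f.map (Int.castRingHom (ZMod p))).natDegree := by
  rw [Polynomial.map_mul, map_C, natDegree_C_mul]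
  rwa [eq_intCast, Ne, ZMod.intCast_zmod_eq_zero_iff_dvd]

theorem norm_completeExpSum_le_pow_card_primeFactors {k : ℕ} {q : ℕ} (hk : 1 ≤ k) :
    0 < q → ∀ f : ℤ[X], f.natDegree ≤ k →
      (∀ p : ℕ, p.Prime → p ∣ q → 1 ≤ (f.map (Int.castRingHom (ZMod p))).natDegree) →
      ‖completeExpSum q f‖ ≤ ((2 * k * k.factorial + k ^ 3) * k : ℝ) ^ q.primeFactors.card *
        (q : ℝ) ^ (1 - 1 / (k : ℝ)) := by
  induction q using Nat.recOnPosPrimePosCoprime with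
  | zero => intro h; exact absurd h (lt_irrefl 0)
  | one => intro _ f _ _; simpa using norm_completeExpSum_le 1 f
  | prime_pow p n hp hn =>
    intro _ f hfk hf
    have : Fact p.Prime := ⟨hp⟩
    have h := norm_completeExpSum_prime_pow_le hn hfk (hf p hp (dvd_pow_self _ (by omega)))
    rwa [Nat.primeFactors_prime_pow (by omega) hp, Finset.card_singleton, pow_one]
  | coprime a b ha hb hab iha ihb =>
    intro _ f hfk hf
    obtain ⟨v, u, huv⟩ := Nat.isCoprime_iff_coprime.mpr hab
    have hu : ∀ p : ℕ, p.Prime → p ∣ a → ¬ (p : ℤ) ∣ u := by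
      intro p hp hpa hpu
      have h1 : (p : ℤ) ∣ 1 := huv ▸ dvd_add
        (Dvd.dvd.mul_left (Int.natCast_dvd_natCast.mpr hpa) v) (Dvd.dvd.mul_right hpu _)
      exact (Nat.prime_iff_prime_int.mp hp).not_isUnit (isUnit_of_dvd_one h1)
    have hv : ∀ p : ℕ, p.Prime → p ∣ b → ¬ (p : ℤ) ∣ v := by
      intro p hp hpb hpv
      have h1 : (p : ℤ) ∣ 1 := huv ▸ dvd_add (Dvd.dvd.mul_right hpv _)
        (Dvd.dvd.mul_left (Int.natCast_dvd_natCast.mpr hpb) u)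
      exact (Nat.prime_iff_prime_int.mp hp).not_isUnit (isUnit_of_dvd_one h1)
    have h1 := iha (by omega) (C u * f) ((natDegree_C_mul_le _ _).trans hfk) (fun p hp hpa => by
      have : Fact p.Prime := ⟨hp⟩
      rw [natDegree_map_C_mul_zmod (hu p hp hpa)]
      exact hf p hp (hpa.mul_right _))
    have h2 := ihb (by omega) (C v * f) ((natDegree_C_mul_le _ _).trans hfk) (fun p hp hpb => by
      have : Fact p.Prime := ⟨hp⟩
      rw [natDegree_map_C_mul_zmod (hv p hp hpb)]
      exact hf p hp (hpb.mul_left _))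
    rw [completeExpSum_mul_coprime (by omega) (by omega) (by linarith : u * b + v * a = 1),
      norm_mul, hab.primeFactors_mul, Finset.card_union_of_disjoint hab.disjoint_primeFactors,
      pow_add, Nat.cast_mul, Real.mul_rpow (by positivity) (by positivity)]
    calc _ ≤ _ := mul_le_mul h1 h2 (norm_nonneg _) (by positivity)
      _ = _ := by ring

/-- Once p ≥ A^(1/ε), the factor A is at most p^ε; the fewer than M remaining primes cost at most
A^M. -/
theorem exists_pow_card_primeFactors_le {A ε : ℝ} (hA : 1 ≤ A) (hε : 0 < ε) :
    ∃ K : ℝ, 0 < K ∧ ∀ q : ℕ, 0 < q → A ^ q.primeFactors.card ≤ K * (q : ℝ) ^ ε := by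
  obtain ⟨M, hM⟩ := exists_nat_ge (A ^ (1 / ε))
  refine ⟨A ^ M, by positivity, fun q hq => ?_⟩
  have h1 : ∀ p ∈ q.primeFactors, A ≤ (if p < M then A else 1) * (p : ℝ) ^ ε := by
    intro p hp
    have hp1 : (1 : ℝ) ≤ p := by exact_mod_cast (Nat.prime_of_mem_primeFactors hp).one_lt.le
    split_ifs with h
    · exact le_mul_of_one_le_right (by linarith) (Real.one_le_rpow hp1 hε.le)
    · rw [one_mul]
      have h2 : A ^ (1 / ε) ≤ p := hM.trans (by exact_mod_cast not_lt.mp h)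
      calc A = (A ^ (1 / ε)) ^ ε := by
            rw [← Real.rpow_mul (by linarith), one_div_mul_cancel hε.ne', Real.rpow_one]
        _ ≤ _ := by gcongr
  calc A ^ q.primeFactors.card = ∏ p ∈ q.primeFactors, A := by rw [Finset.prod_const]
    _ ≤ ∏ p ∈ q.primeFactors, ((if p < M then A else 1) * (p : ℝ) ^ ε) :=
        Finset.prod_le_prod (fun _ _ => by linarith) h1
    _ = A ^ (q.primeFactors.filter (· < M)).card * ((∏ p ∈ q.primeFactors, p : ℕ) : ℝ) ^ ε := by
        rw [Finset.prod_mul_distrib, Real.finsetProd_rpow _ _ (fun _ _ => by positivity),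
          Finset.prod_ite]
        simp
    _ ≤ A ^ M * (q : ℝ) ^ ε := by
        have h2 : (q.primeFactors.filter (· < M)).card ≤ M := by
          calc _ ≤ (Finset.range M).card := Finset.card_le_card (fun x hx => by
                simpa using (Finset.mem_filter.mp hx).2)
            _ = M := Finset.card_range M
        have h3 := Nat.le_of_dvd hq (Nat.prod_primeFactors_dvd q)
        gcongr

theorem exists_norm_completeExpSum_le {k : ℕ} (hk : 1 ≤ k) {ε : ℝ} (hε : 0 < ε) :
    ∃ K : ℝ, 0 < K ∧ ∀ (q : ℕ) (f : ℤ[X]), 0 < q → f.natDegree ≤ k →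
      (∀ p : ℕ, p.Prime → p ∣ q → 1 ≤ (f.map (Int.castRingHom (ZMod p))).natDegree) →
      ‖completeExpSum q f‖ ≤ K * (q : ℝ) ^ (1 - 1 / (k : ℝ) + ε) := by
  have hA : (1 : ℝ) ≤ (2 * k * k.factorial + k ^ 3) * k := by
    have : 1 ≤ (2 * k * k.factorial + k ^ 3) * k := Nat.one_le_iff_ne_zero.mpr (by positivity)
    exact_mod_cast this
  obtain ⟨K, hK, h⟩ := exists_pow_card_primeFactors_le hA hε
  refine ⟨K, hK, fun q f hq hfk hf => ?_⟩
  have hq' : (0 : ℝ) < q := by exact_mod_cast hq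
  refine (norm_completeExpSum_le_pow_card_primeFactors hk hq f hfk hf).trans ?_
  rw [add_comm _ ε, Real.rpow_add hq', ← mul_assoc]
  gcongr
  exact h q hq

/-- Bernoulli gives p^(nε) ≥ 1 + n(2^ε - 1), and the factor 1 + 1/(2^ε - 1) lifts this to at least n
+ 1. -/
theorem card_divisors_le_pow_card_primeFactors {ε : ℝ} (hε : 0 < ε) {q : ℕ} :
    0 < q → (q.divisors.card : ℝ) ≤
      (1 + 1 / ((2 : ℝ) ^ ε - 1)) ^ q.primeFactors.card * (q : ℝ) ^ ε := by
  have hx : 0 < (2 : ℝ) ^ ε - 1 := sub_pos.mpr (Real.one_lt_rpow (by norm_num) hε)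
  induction q using Nat.recOnPosPrimePosCoprime with
  | zero => intro h; exact absurd h (lt_irrefl 0)
  | one => intro _; simp
  | prime_pow p n hp hn =>
    intro _
    rw [Nat.primeFactors_prime_pow (by omega) hp, Finset.card_singleton, pow_one,
      Nat.divisors_prime_pow hp, Finset.card_map, Finset.card_range]
    have h1 := one_add_mul_le_pow (a := (2 : ℝ) ^ ε - 1) (by linarith) n
    have h2 : (2 : ℝ) ^ ε ≤ (p : ℝ) ^ ε := by
      have : (2 : ℝ) ≤ p := by exact_mod_cast hp.two_le
      gcongr
    have h3 : ((p ^ n : ℕ) : ℝ) ^ ε = ((p : ℝ) ^ ε) ^ n := by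
      rw [Nat.cast_pow, ← Real.rpow_natCast, ← Real.rpow_natCast, ← Real.rpow_mul (by positivity),
        ← Real.rpow_mul (by positivity), mul_comm]
    rw [h3]
    calc ((n + 1 : ℕ) : ℝ) ≤ (1 + 1 / ((2 : ℝ) ^ ε - 1)) * (1 + n * ((2 : ℝ) ^ ε - 1)) := by
          have e : (1 + 1 / ((2 : ℝ) ^ ε - 1)) * (1 + n * ((2 : ℝ) ^ ε - 1)) =
              1 + n + 1 / ((2 : ℝ) ^ ε - 1) + n * ((2 : ℝ) ^ ε - 1) := by
            field_simp; ring
          rw [e]; push_cast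
          have : 0 ≤ 1 / ((2 : ℝ) ^ ε - 1) := by positivity
          have : 0 ≤ n * ((2 : ℝ) ^ ε - 1) := by positivity
          linarith
      _ ≤ (1 + 1 / ((2 : ℝ) ^ ε - 1)) * ((p : ℝ) ^ ε) ^ n := by
          gcongr
          refine h1.trans ?_
          rw [add_sub_cancel]
          gcongr
  | coprime a b ha hb hab iha ihb =>
    intro _
    rw [hab.card_divisors_mul, hab.primeFactors_mul,
      Finset.card_union_of_disjoint hab.disjoint_primeFactors, pow_add, Nat.cast_mul, Nat.cast_mul,
      Real.mul_rpow (by positivity) (by positivity)]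
    calc _ ≤ _ := mul_le_mul (iha (by omega)) (ihb (by omega)) (by positivity) (by positivity)
      _ = _ := by ring

theorem exists_card_divisors_le {ε : ℝ} (hε : 0 < ε) :
    ∃ K : ℝ, 0 < K ∧ ∀ q : ℕ, 0 < q → (q.divisors.card : ℝ) ≤ K * (q : ℝ) ^ ε := by
  have hx : 0 < (2 : ℝ) ^ (ε / 2) - 1 :=
    sub_pos.mpr (Real.one_lt_rpow (by norm_num) (by linarith))
  obtain ⟨K, hK, h⟩ := exists_pow_card_primeFactors_le
    (A := 1 + 1 / ((2 : ℝ) ^ (ε / 2) - 1)) (by rw [le_add_iff_nonneg_right]; positivity)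
    (half_pos hε)
  refine ⟨K, hK, fun q hq => ?_⟩
  have hq' : (0 : ℝ) < q := by exact_mod_cast hq
  refine (card_divisors_le_pow_card_primeFactors (half_pos hε) hq).trans ?_
  rw [← add_halves ε, Real.rpow_add hq', ← mul_assoc, add_halves]
  gcongr
  exact h q hq

/-! ### Counting residues in an interval by Fourier analysis -/

/-- Jordan's inequality gives q/(2 min(k, q - k)); the sum of both reciprocals replaces the minimum,
to be folded later by k ↦ q - k. -/
theorem two_div_norm_rootExp_sub_one_le {q k : ℕ} (hk : 0 < k) (hkq : k < q) :
    2 / ‖rootExp q (-(k : ℤ)) - 1‖ ≤ q * (1 / 2 * (1 / (k : ℝ) + 1 / ((q - k : ℕ) : ℝ))) := by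
  have hq : (0 : ℝ) < q := by exact_mod_cast (by omega : 0 < q)
  have hkR : (0 : ℝ) < k := by exact_mod_cast hk
  have hqk : (0 : ℝ) < ((q - k : ℕ) : ℝ) := by exact_mod_cast (by omega : 0 < q - k)
  have hcast : ((q - k : ℕ) : ℝ) = q - k := by rw [Nat.cast_sub hkq.le]
  have hnorm : ‖rootExp q (-(k : ℤ)) - 1‖ = 2 * |Real.sin (Real.pi * (k / q))| := by
    have h1 : rootExp q (-(k : ℤ)) =
        Complex.exp (Complex.I * ((-(2 * (Real.pi * (k / q))) : ℝ) : ℂ)) := by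
      rw [rootExp]; push_cast; ring_nf
    rw [h1, Complex.norm_exp_I_mul_ofReal_sub_one, norm_mul, Real.norm_eq_abs, Real.norm_eq_abs,
      abs_of_pos (by norm_num : (0 : ℝ) < 2),
      show -(2 * (Real.pi * ((k : ℝ) / q))) / 2 = -(Real.pi * (k / q)) by ring, Real.sin_neg, abs_neg]
  have hpi := Real.pi_pos
  have hlow : ∀ t : ℝ, 0 ≤ t → t ≤ 1 / 2 → 2 * t ≤ Real.sin (Real.pi * t) := by
    intro t h0 h1
    have h2 := Real.mul_le_sin (x := Real.pi * t) (by positivity) (by nlinarith)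
    have e : 2 / Real.pi * (Real.pi * t) = 2 * t := by field_simp
    linarith
  have hone : (k : ℝ) / q + (q - k : ℕ) / q = 1 := by rw [hcast]; field_simp; ring
  rw [hnorm]
  rcases le_total ((k : ℝ) / q) (1 / 2) with h | h
  · have h1 := (hlow _ (by positivity) h).trans (le_abs_self _)
    calc 2 / (2 * |Real.sin (Real.pi * (k / q))|) ≤ 2 / (2 * (2 * (k / q))) := by gcongr
      _ = q * (1 / 2 * (1 / (k : ℝ) + 0)) := by field_simp; ring
      _ ≤ _ := by gcongr; positivity
  · have h1 := (hlow ((q - k : ℕ) / q) (by positivity) (by linarith))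
    have h2 : Real.sin (Real.pi * ((q - k : ℕ) / q)) = Real.sin (Real.pi * (k / q)) := by
      rw [← Real.sin_pi_sub, show ((q - k : ℕ) : ℝ) / q = 1 - k / q by linarith]
      ring_nf
    rw [h2] at h1
    replace h1 := h1.trans (le_abs_self _)
    calc 2 / (2 * |Real.sin (Real.pi * (k / q))|) ≤ 2 / (2 * (2 * ((q - k : ℕ) / q))) := by gcongr
      _ = q * (1 / 2 * (0 + 1 / ((q - k : ℕ) : ℝ))) := by field_simp; ring
      _ ≤ _ := by gcongr; positivity

theorem norm_sum_Ico_rootExp_le {q k : ℕ} (hk : 0 < k) (hkq : k < q) {A B : ℕ} (hAB : A ≤ B) :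
    ‖∑ a ∈ Finset.Ico A B, rootExp q (-(k : ℤ) * a)‖ ≤
      q * (1 / 2 * (1 / (k : ℝ) + 1 / ((q - k : ℕ) : ℝ))) := by
  have hne : rootExp q (-(k : ℤ)) ≠ 1 := by
    rw [Ne, rootExp_eq_one_iff (by omega), dvd_neg, Int.natCast_dvd_natCast]
    intro h
    have := Nat.le_of_dvd hk h
    omega
  simp only [rootExp_mul_nat]
  rw [geom_sum_Ico hne hAB, norm_div]
  refine le_trans ?_ (two_div_norm_rootExp_sub_one_le hk hkq)
  gcongr
  refine (norm_sub_le _ _).trans ?_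
  rw [norm_pow, norm_pow, norm_rootExp, one_pow, one_pow]
  norm_num

theorem sum_range_rootExp_mul {q : ℕ} (hq : 0 < q) (m : ℤ) :
    ∑ k ∈ Finset.range q, rootExp q (m * k) = if (q : ℤ) ∣ m then (q : ℂ) else 0 := by
  simp only [rootExp_mul_nat]
  split_ifs with h
  · simp [(rootExp_eq_one_iff hq m).mpr h]
  · rw [geom_sum_eq (fun h1 => h ((rootExp_eq_one_iff hq m).mp h1)), ← rootExp_mul_nat,
      (rootExp_eq_one_iff hq _).mpr (Dvd.intro_left _ rfl), sub_self, zero_div]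

theorem sum_Ico_ite_dvd {q : ℕ} {A B : ℕ} (hB : B ≤ q) (hq : 0 < q) (y : ℤ) :
    ∑ a ∈ Finset.Ico A B, (if (q : ℤ) ∣ y - a then (q : ℂ) else 0) =
      if (A : ℤ) ≤ y % q ∧ y % q < B then (q : ℂ) else 0 := by
  have hq' : (0 : ℤ) < q := by exact_mod_cast hq
  have h0 := Int.emod_nonneg y hq'.ne'
  have h1 := Int.emod_lt_of_pos y hq'
  have hiff : ∀ a ∈ Finset.Ico A B, ((q : ℤ) ∣ y - a ↔ (y % q).toNat = a) := by
    intro a ha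
    have ha' := Finset.mem_Ico.mp ha
    have h2 : ((a : ℤ) % q) = a := Int.emod_eq_of_lt (by omega) (by omega)
    rw [Int.dvd_iff_emod_eq_zero, ← Int.emod_eq_emod_iff_emod_sub_eq_zero, h2]
    omega
  rw [Finset.sum_congr rfl (g := fun a => if (y % q).toNat = a then (q : ℂ) else 0)
    (fun a ha => by simp only [hiff a ha]), Finset.sum_ite_eq]
  congr 1
  rw [Finset.mem_Ico, eq_iff_iff]
  omega

/-- Orthogonality detects each residue in [A, B). The frequency k = 0 yields the main term B - A,
and every other one factors into a geometric sum and an exponential sum over n. -/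
theorem abs_card_sub_le_sum_norm {q : ℕ} (hq : 0 < q) {A B : ℕ} (hAB : A ≤ B) (hB : B ≤ q)
    (y : ℕ → ℤ) :
    |(((Finset.range q).filter fun n => (A : ℤ) ≤ y n % q ∧ y n % q < B).card : ℝ) - (B - A)| ≤
      ∑ k ∈ Finset.Ico 1 q, 1 / 2 * (1 / (k : ℝ) + 1 / ((q - k : ℕ) : ℝ)) *
        ‖∑ n ∈ Finset.range q, rootExp q (k * y n)‖ := by
  set N := ((Finset.range q).filter fun n => (A : ℤ) ≤ y n % q ∧ y n % q < B).card with hN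
  have hqR : (0 : ℝ) < q := by exact_mod_cast hq
  have h1 : (q : ℂ) * N = ∑ k ∈ Finset.range q, (∑ a ∈ Finset.Ico A B, rootExp q (-(k : ℤ) * a)) *
      ∑ n ∈ Finset.range q, rootExp q (k * y n) := by
    calc (q : ℂ) * N = ∑ n ∈ Finset.range q,
          if (A : ℤ) ≤ y n % q ∧ y n % q < B then (q : ℂ) else 0 := by
          rw [← Finset.sum_filter, Finset.sum_const, nsmul_eq_mul, mul_comm]
      _ = ∑ n ∈ Finset.range q, ∑ a ∈ Finset.Ico A B, ∑ k ∈ Finset.range q,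
            rootExp q ((y n - a) * k) := by
          refine Finset.sum_congr rfl fun n _ => ?_
          rw [← sum_Ico_ite_dvd hB hq]
          refine Finset.sum_congr rfl fun a _ => ?_
          rw [sum_range_rootExp_mul hq]
      _ = ∑ n ∈ Finset.range q, ∑ k ∈ Finset.range q, ∑ a ∈ Finset.Ico A B,
            rootExp q (-(k : ℤ) * a) * rootExp q (k * y n) := by
          refine Finset.sum_congr rfl fun n _ => ?_
          rw [Finset.sum_comm]
          refine Finset.sum_congr rfl fun k _ => Finset.sum_congr rfl fun a _ => ?_
          rw [← rootExp_add]; congr 1; ring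
      _ = _ := by
          rw [Finset.sum_comm]
          refine Finset.sum_congr rfl fun k _ => ?_
          rw [Finset.sum_mul_sum, Finset.sum_comm]
  rw [Finset.range_eq_Ico, Finset.sum_eq_sum_Ico_succ_bot hq, ← Finset.range_eq_Ico] at h1
  have h0 : (∑ a ∈ Finset.Ico A B, rootExp q (-((0 : ℕ) : ℤ) * a)) *
      ∑ n ∈ Finset.range q, rootExp q ((0 : ℕ) * y n) = q * ((B : ℂ) - A) := by
    simp only [Nat.cast_zero, neg_zero, zero_mul, rootExp_zero]
    simp [Nat.cast_sub hAB, mul_comm]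
  rw [h0] at h1
  have h2 : (q : ℂ) * (((N : ℝ) - (B - A) : ℝ) : ℂ) = ∑ k ∈ Finset.Ico 1 q,
      (∑ a ∈ Finset.Ico A B, rootExp q (-(k : ℤ) * a)) *
      ∑ n ∈ Finset.range q, rootExp q (k * y n) := by
    push_cast
    linear_combination h1
  have h3 := congrArg norm h2
  rw [norm_mul, Complex.norm_natCast, Complex.norm_real, Real.norm_eq_abs] at h3
  have h4 : (q : ℝ) * |(N : ℝ) - (B - A)| ≤ q * ∑ k ∈ Finset.Ico 1 q,
      1 / 2 * (1 / (k : ℝ) + 1 / ((q - k : ℕ) : ℝ)) *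
        ‖∑ n ∈ Finset.range q, rootExp q (k * y n)‖ := by
    rw [h3, Finset.mul_sum]
    refine (norm_sum_le _ _).trans (Finset.sum_le_sum fun k hk => ?_)
    have hk' := Finset.mem_Ico.mp hk
    rw [norm_mul, ← mul_assoc]
    gcongr
    exact norm_sum_Ico_rootExp_le (by omega) hk'.2 hAB
  exact le_of_mul_le_mul_left h4 hqR

/-- The gcd is one of the common divisors e, so a sum over all of them dominates. With k = e j, each
term is at most 1/j since θ ≤ 1, leaving a harmonic sum for each divisor of q. -/
theorem sum_one_div_mul_gcd_rpow_le {q : ℕ} {θ : ℝ} (hθ : θ ≤ 1) :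
    ∑ k ∈ Finset.Ico 1 q, 1 / (k : ℝ) * (Nat.gcd k q : ℝ) ^ θ ≤
      q.divisors.card * (1 + Real.log q) := by
  have hH : ∑ j ∈ Finset.Icc 1 q, 1 / (j : ℝ) ≤ 1 + Real.log q := by
    have := harmonic_le_one_add_log q
    rw [harmonic_eq_sum_Icc] at this
    push_cast at this
    simpa only [one_div] using this
  have h1 : ∀ k ∈ Finset.Ico 1 q, 1 / (k : ℝ) * (Nat.gcd k q : ℝ) ^ θ ≤
      ∑ e ∈ q.divisors, if e ∣ k then 1 / (k : ℝ) * (e : ℝ) ^ θ else 0 := by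
    intro k hk
    have hk' := Finset.mem_Ico.mp hk
    have h2 : Nat.gcd k q ∈ q.divisors :=
      Nat.mem_divisors.mpr ⟨Nat.gcd_dvd_right _ _, by omega⟩
    refine le_trans (le_of_eq ?_) (Finset.single_le_sum
      (f := fun e : ℕ => if e ∣ k then 1 / (k : ℝ) * (e : ℝ) ^ θ else 0)
      (fun e _ => by split_ifs <;> positivity) h2)
    rw [if_pos (Nat.gcd_dvd_left _ _)]
  have h3 : ∀ e ∈ q.divisors, ∑ k ∈ Finset.Ico 1 q,
      (if e ∣ k then 1 / (k : ℝ) * (e : ℝ) ^ θ else 0) ≤ 1 + Real.log q := by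
    intro e he
    have he0 : 0 < e := Nat.pos_of_mem_divisors he
    have he1 : (1 : ℝ) ≤ e := by exact_mod_cast he0
    refine le_trans ?_ hH
    rw [← Finset.sum_filter]
    calc _ ≤ ∑ k ∈ Finset.Ico 1 q with e ∣ k, 1 / ((k / e : ℕ) : ℝ) := by
          refine Finset.sum_le_sum fun k hk => ?_
          obtain ⟨hk1, j, rfl⟩ := Finset.mem_filter.mp hk
          have hj : 0 < j := Nat.pos_of_ne_zero (by rintro rfl; simp at hk1)
          rw [Nat.mul_div_cancel_left _ he0]
          have : (e : ℝ) ^ θ ≤ e := by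
            simpa using Real.rpow_le_rpow_of_exponent_le he1 hθ
          push_cast
          calc 1 / ((e : ℝ) * j) * (e : ℝ) ^ θ ≤ 1 / ((e : ℝ) * j) * e := by gcongr
            _ = _ := by field_simp
      _ = ∑ j ∈ (Finset.filter (e ∣ ·) (Finset.Ico 1 q)).image (· / e), 1 / (j : ℝ) := by
          rw [Finset.sum_image]
          intro a ha b hb hab
          obtain ⟨_, i, rfl⟩ := Finset.mem_filter.mp ha
          obtain ⟨_, j, rfl⟩ := Finset.mem_filter.mp hb
          simp only [Nat.mul_div_cancel_left _ he0] at hab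
          rw [hab]
      _ ≤ _ := by
          refine Finset.sum_le_sum_of_subset_of_nonneg ?_ (fun _ _ _ => by positivity)
          intro j hj
          obtain ⟨k, hk, rfl⟩ := Finset.mem_image.mp hj
          obtain ⟨hk1, i, rfl⟩ := Finset.mem_filter.mp hk
          have hk2 := Finset.mem_Ico.mp hk1
          have : i ≤ e * i := Nat.le_mul_of_pos_left i he0
          have hi : 0 < i := Nat.pos_of_ne_zero (by rintro rfl; simp at hk1)
          simp only [Nat.mul_div_cancel_left _ he0, Finset.mem_Icc]
          omega
  calc _ ≤ _ := Finset.sum_le_sum h1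
    _ = _ := Finset.sum_comm
    _ ≤ ∑ e ∈ q.divisors, (1 + Real.log q) := Finset.sum_le_sum h3
    _ = _ := by rw [Finset.sum_const, nsmul_eq_mul]

theorem sum_range_rootExp_mul_eval {q k : ℕ} (hq : 0 < q) (f : ℤ[X]) :
    ∑ n ∈ Finset.range q, rootExp q (k * f.eval (n : ℤ)) =
      Nat.gcd k q * completeExpSum (q / Nat.gcd k q) (C ((k / Nat.gcd k q : ℕ) : ℤ) * f) := by
  set g := Nat.gcd k q with hg
  have hg0 : 0 < g := Nat.gcd_pos_of_pos_right _ hq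
  obtain ⟨q', hq'⟩ : g ∣ q := Nat.gcd_dvd_right _ _
  obtain ⟨k', hk'⟩ : g ∣ k := Nat.gcd_dvd_left _ _
  clear_value g
  subst hq' hk'
  have hq'0 : 0 < q' := Nat.pos_of_mul_pos_left hq
  rw [Nat.mul_div_cancel_left _ hg0, Nat.mul_div_cancel_left _ hg0]
  have h1 : ∀ n : ℕ, rootExp (g * q') ((g * k' : ℕ) * f.eval (n : ℤ)) =
      rootExp q' ((C (k' : ℤ) * f).eval (n : ℤ)) := by
    intro n
    rw [eval_mul, eval_C, ← rootExp_mul_left hg0 q']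
    push_cast
    rw [mul_assoc]
  simp only [h1]
  rw [mul_comm g q', sum_range_mul_eq, completeExpSum, Finset.mul_sum]
  refine Finset.sum_congr rfl fun y _ => ?_
  rw [Finset.sum_congr rfl (g := fun _ => rootExp q' ((C (k' : ℤ) * f).eval (y : ℤ)))]
  · simp
  · intro z _
    apply rootExp_congr hq'0
    refine dvd_trans ?_ ((C (k' : ℤ) * f).sub_dvd_eval_sub _ _)
    push_cast
    exact ⟨z, by ring⟩

theorem exists_abs_card_sub_le {d : ℕ} (hd : 1 ≤ d) :
    ∃ K : ℝ, 0 < K ∧ ∀ (q : ℕ) (f : ℤ[X]), 0 < q → f.natDegree ≤ d →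
      (∀ p : ℕ, p.Prime → p ∣ q → 1 ≤ (f.map (Int.castRingHom (ZMod p))).natDegree) →
      ∀ A B : ℕ, A ≤ B → B ≤ q →
      |(((Finset.range q).filter fun n : ℕ =>
        (A : ℤ) ≤ f.eval (n : ℤ) % q ∧ f.eval (n : ℤ) % q < B).card : ℝ) - (B - A)| ≤
        K * (q : ℝ) ^ (1 - 1 / ((d : ℝ) + 1)) := by
  have hdR : (1 : ℝ) ≤ d := by exact_mod_cast hd
  -- A third of the gap: one ε each for the exponential sums, the divisor function and the
  -- logarithm.
  obtain ⟨ε, hε⟩ : ∃ ε : ℝ, ε = (1 / (d : ℝ) - 1 / ((d : ℝ) + 1)) / 3 := ⟨_, rfl⟩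
  have hε0 : 0 < ε := by
    rw [hε]
    have : 1 / ((d : ℝ) + 1) < 1 / d := by gcongr; linarith
    linarith
  obtain ⟨θ, hθ⟩ : ∃ θ : ℝ, θ = 1 / (d : ℝ) - ε := ⟨_, rfl⟩
  have hθ1 : θ ≤ 1 := by
    have : 1 / (d : ℝ) ≤ 1 := (div_le_one (by linarith)).mpr hdR
    linarith
  obtain ⟨K₁, hK₁, hS⟩ := exists_norm_completeExpSum_le hd hε0
  obtain ⟨K₂, hK₂, hτ⟩ := exists_card_divisors_le hε0
  refine ⟨K₁ * (K₂ * (1 + 1 / ε)), by positivity, fun q f hq hfd hf A B hAB hB => ?_⟩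
  have hqR : (0 : ℝ) < q := by exact_mod_cast hq
  have hq1 : (1 : ℝ) ≤ q := by exact_mod_cast hq
  refine (abs_card_sub_le_sum_norm hq hAB hB (fun n => f.eval (n : ℤ))).trans ?_
  have hT : ∀ k ∈ Finset.Ico 1 q, ‖∑ n ∈ Finset.range q, rootExp q (k * f.eval (n : ℤ))‖ ≤
      K₁ * (q : ℝ) ^ (1 - θ) * (Nat.gcd k q : ℝ) ^ θ := by
    intro k hk
    have hk' := Finset.mem_Ico.mp hk
    rw [sum_range_rootExp_mul_eval hq, norm_mul, Complex.norm_natCast]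
    have hg0 : 0 < Nat.gcd k q := Nat.gcd_pos_of_pos_right _ hq
    have hgR : (0 : ℝ) < Nat.gcd k q := by exact_mod_cast hg0
    have hcop : Nat.Coprime (k / Nat.gcd k q) (q / Nat.gcd k q) := Nat.coprime_div_gcd_div_gcd hg0
    have h1 := hS (q / Nat.gcd k q) (C ((k / Nat.gcd k q : ℕ) : ℤ) * f)
      (Nat.div_pos (Nat.le_of_dvd hq (Nat.gcd_dvd_right _ _)) hg0)
      ((natDegree_C_mul_le _ _).trans hfd) (fun p hp hpq => by
        have : Fact p.Prime := ⟨hp⟩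
        rw [natDegree_map_C_mul_zmod]
        · exact hf p hp (hpq.trans (Nat.div_dvd_of_dvd (Nat.gcd_dvd_right _ _)))
        · rw [Int.natCast_dvd_natCast]
          intro h
          exact hp.one_lt.ne' (Nat.eq_one_of_dvd_coprimes hcop h hpq))
    rw [show 1 - 1 / (d : ℝ) + ε = 1 - θ by rw [hθ]; ring,
      Nat.cast_div (Nat.gcd_dvd_right _ _) hgR.ne', Real.div_rpow hqR.le hgR.le] at h1
    calc _ ≤ (Nat.gcd k q : ℝ) * (K₁ * ((q : ℝ) ^ (1 - θ) / (Nat.gcd k q : ℝ) ^ (1 - θ))) := by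
          gcongr
      _ = K₁ * (q : ℝ) ^ (1 - θ) * ((Nat.gcd k q : ℝ) ^ (1 : ℝ) / (Nat.gcd k q : ℝ) ^ (1 - θ)) := by
          rw [Real.rpow_one]; ring
      _ = _ := by
          rw [← Real.rpow_sub hgR]; congr 2; ring
  have hsym : ∑ k ∈ Finset.Ico 1 q, 1 / ((q - k : ℕ) : ℝ) * (Nat.gcd k q : ℝ) ^ θ =
      ∑ k ∈ Finset.Ico 1 q, 1 / (k : ℝ) * (Nat.gcd k q : ℝ) ^ θ := by
    refine Finset.sum_bij' (fun k _ => q - k) (fun k _ => q - k) ?_ ?_ ?_ ?_ ?_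
    · intro k hk; simp only [Finset.mem_Ico] at hk ⊢; omega
    · intro k hk; simp only [Finset.mem_Ico] at hk ⊢; omega
    · intro k hk; simp only [Finset.mem_Ico] at hk; omega
    · intro k hk; simp only [Finset.mem_Ico] at hk; omega
    · intro k hk
      simp only [Finset.mem_Ico] at hk
      rw [Nat.gcd_self_sub_left hk.2.le, Nat.gcd_comm]
  have hlog : 1 + Real.log q ≤ (1 + 1 / ε) * (q : ℝ) ^ ε := by
    have h1 := Real.log_le_rpow_div hqR.le hε0
    have h2 : 1 ≤ (q : ℝ) ^ ε := Real.one_le_rpow hq1 hε0.le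
    calc _ ≤ (q : ℝ) ^ ε + (q : ℝ) ^ ε / ε := by linarith
      _ = _ := by ring
  calc _ ≤ ∑ k ∈ Finset.Ico 1 q, 1 / 2 * (1 / (k : ℝ) + 1 / ((q - k : ℕ) : ℝ)) *
        (K₁ * (q : ℝ) ^ (1 - θ) * (Nat.gcd k q : ℝ) ^ θ) := by
        refine Finset.sum_le_sum fun k hk => ?_
        gcongr
        exact hT k hk
    _ = K₁ * (q : ℝ) ^ (1 - θ) * (1 / 2 *
        (∑ k ∈ Finset.Ico 1 q, 1 / (k : ℝ) * (Nat.gcd k q : ℝ) ^ θ +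
          ∑ k ∈ Finset.Ico 1 q, 1 / ((q - k : ℕ) : ℝ) * (Nat.gcd k q : ℝ) ^ θ)) := by
        rw [← Finset.sum_add_distrib, Finset.mul_sum, Finset.mul_sum]
        refine Finset.sum_congr rfl fun k _ => ?_
        ring
    _ = K₁ * (q : ℝ) ^ (1 - θ) *
        ∑ k ∈ Finset.Ico 1 q, 1 / (k : ℝ) * (Nat.gcd k q : ℝ) ^ θ := by rw [hsym]; ring
    _ ≤ K₁ * (q : ℝ) ^ (1 - θ) * ((K₂ * (q : ℝ) ^ ε) * ((1 + 1 / ε) * (q : ℝ) ^ ε)) := by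
        gcongr
        refine (sum_one_div_mul_gcd_rpow_le hθ1).trans ?_
        have h1 := hτ q hq
        have h2 := Real.log_nonneg hq1
        gcongr
    _ = K₁ * (K₂ * (1 + 1 / ε)) * ((q : ℝ) ^ (1 - θ) * (q : ℝ) ^ ε * (q : ℝ) ^ ε) := by ring
    _ = _ := by
        rw [← Real.rpow_add hqR, ← Real.rpow_add hqR]
        congr 2
        rw [hθ, hε]; ring

/-! ### Removing the gcd and passing to the discrepancy -/

theorem coeffGcd_pos {d : ℕ} {P : ℤ[X]} {q : ℕ} (hq : 0 < q) : 0 < coeffGcd d P q :=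
  Nat.gcd_pos_of_pos_right _ hq

theorem coeffGcd_dvd_coeff {d : ℕ} {P : ℤ[X]} {q j : ℕ} (hj : 1 ≤ j) (hjd : j ≤ d) :
    (coeffGcd d P q : ℤ) ∣ P.coeff j := by
  rw [Int.natCast_dvd]
  exact (Nat.gcd_dvd_left _ _).trans
    (Finset.gcd_dvd (f := fun j => (P.coeff j).natAbs) (Finset.mem_Icc.mpr ⟨hj, hjd⟩))

theorem exists_eq_C_add_C_mul {d : ℕ} {P : ℤ[X]} {q : ℕ} (hP : P.natDegree = d) (hq : 0 < q) :
    ∃ (r : ℤ) (f : ℤ[X]), 0 ≤ r ∧ r < coeffGcd d P q ∧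
      P = C r + C (coeffGcd d P q : ℤ) * f ∧ f.natDegree ≤ d ∧
      ∀ p : ℕ, p.Prime → p ∣ q / coeffGcd d P q →
        1 ≤ (f.map (Int.castRingHom (ZMod p))).natDegree := by
  set g := coeffGcd d P q with hg
  have hg0 : 0 < g := coeffGcd_pos hq
  have hgZ : (0 : ℤ) < g := by exact_mod_cast hg0
  have hdvd : C (g : ℤ) ∣ P - C (P.coeff 0 % g) := by
    rw [C_dvd_iff_dvd_coeff]
    intro j
    rcases Nat.eq_zero_or_pos j with rfl | hj
    · rw [coeff_sub, coeff_C_zero]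
      exact Int.dvd_self_sub_emod
    · rw [coeff_sub, coeff_C, if_neg (by omega), sub_zero]
      rcases Nat.lt_or_ge d j with hjd | hjd
      · rw [coeff_eq_zero_of_natDegree_lt (by omega)]; exact dvd_zero _
      · exact coeffGcd_dvd_coeff hj hjd
  obtain ⟨f, hf⟩ := hdvd
  have hPf : P = C (P.coeff 0 % g) + C (g : ℤ) * f := by rw [← hf]; ring
  refine ⟨P.coeff 0 % g, f, Int.emod_nonneg _ hgZ.ne', Int.emod_lt_of_pos _ hgZ, hPf, ?_, ?_⟩
  · rw [← natDegree_C_mul (p := f) hgZ.ne', ← hf, natDegree_sub_C, hP]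
  · intro p hp hpq
    by_contra hlt
    have hcoeff : ∀ j, 1 ≤ j → (p : ℤ) ∣ f.coeff j := by
      intro j hj
      rw [← int_map_zmod_coeff_eq_zero_iff]
      exact coeff_eq_zero_of_natDegree_lt (by omega)
    -- If f were constant modulo p, then g p would divide q and every nonconstant coefficient of P,
    -- against the maximality of g.
    have h1 : g * p ∣ g := by
      have h2 : g * p ∣ (Finset.Icc 1 d).gcd fun j => (P.coeff j).natAbs := by
        rw [Finset.dvd_gcd_iff]
        intro j hj
        have hj1 := (Finset.mem_Icc.mp hj).1
        rw [← Int.natCast_dvd, hPf, coeff_add, coeff_C, if_neg (by omega), zero_add, coeff_C_mul]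
        push_cast
        exact mul_dvd_mul_left _ (hcoeff j hj1)
      have h3 : g * p ∣ q :=
        Nat.mul_dvd_of_dvd_div (Nat.gcd_dvd_right _ _) hpq
      exact Nat.dvd_gcd h2 h3
    have h4 := Nat.le_of_dvd hg0 h1
    have := hp.two_le
    nlinarith

theorem card_filter_Icc_mul_of_periodic {g q : ℕ} (p : ℕ → Prop) [DecidablePred p]
    (hp : ∀ n m, p (n + q * m) ↔ p n) :
    ((Finset.Icc 1 (q * g)).filter p).card = g * ((Finset.range q).filter p).card := by
  have h1 : Function.Periodic p (q * g) := fun n => propext (hp n g)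
  have h2 := Nat.filter_Ico_card_eq_of_periodic 1 (q * g) p h1
  have h3 : Finset.Ico 1 (1 + q * g) = Finset.Icc 1 (q * g) := by
    ext x; simp only [Finset.mem_Ico, Finset.mem_Icc]; omega
  rw [h3] at h2
  rw [h2, Nat.count_eq_card_filter_range, Finset.card_filter, sum_range_mul_eq, Finset.card_filter,
    Finset.mul_sum]
  simp only [hp, Finset.sum_const, Finset.card_range, smul_eq_mul]

theorem fract_eval_div_eq {g q : ℕ} (hg : 0 < g) (hq : 0 < q) {r : ℤ} (hr0 : 0 ≤ r) (hrg : r < g)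
    (z : ℤ) : Int.fract (((r + g * z : ℤ) : ℝ) / ((q * g : ℕ) : ℝ)) =
      (r + g * ((z % q).toNat : ℝ)) / ((q * g : ℕ) : ℝ) := by
  have hqZ : (0 : ℤ) < q := by exact_mod_cast hq
  have hqR : (0 : ℝ) < q := by exact_mod_cast hq
  have hgR : (0 : ℝ) < g := by exact_mod_cast hg
  obtain ⟨y, hy⟩ := Int.eq_ofNat_of_zero_le (Int.emod_nonneg z hqZ.ne')
  have hyq : y < q := by
    have := Int.emod_lt_of_pos z hqZ
    omega
  have hz := Int.emod_add_mul_ediv z q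
  rw [hy] at hz ⊢
  rw [Int.toNat_natCast, Int.fract_eq_iff]
  have hr0' : (0 : ℝ) ≤ r := by exact_mod_cast hr0
  refine ⟨by positivity, ?_, z / q, ?_⟩
  · rw [div_lt_one (by positivity)]
    have h1 : r + g * y < q * g := by nlinarith
    exact_mod_cast h1
  · rw [← hz]
    push_cast
    have : ((y + q * (z / q) : ℤ) / (q : ℤ)) = z / q := by rw [hz]
    rw [this]
    field_simp
    ring

/-- The natural-number ceiling truncates negative values to 0, which still lies in [t, t + 1] as
long as t > -1. -/
theorem abs_ceil_sub_ceil_sub_le {a b : ℝ} (ha : -1 < a) (hb : -1 < b) :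
    |((⌈b⌉₊ : ℝ) - ⌈a⌉₊) - (b - a)| ≤ 1 := by
  have key : ∀ t : ℝ, -1 < t → t ≤ ⌈t⌉₊ ∧ (⌈t⌉₊ : ℝ) ≤ t + 1 := by
    intro t ht
    refine ⟨Nat.le_ceil t, ?_⟩
    rcases le_total 0 t with h | h
    · exact (Nat.ceil_lt_add_one h).le
    · rw [Nat.ceil_eq_zero.mpr h, Nat.cast_zero]; linarith
  obtain ⟨h1, h2⟩ := key a ha
  obtain ⟨h3, h4⟩ := key b hb
  rw [abs_le]
  constructor <;> linarith

theorem discrepancy_le_of_residue_count {g q : ℕ} (hg : 0 < g) (hq : 0 < q) {r : ℤ} (hr0 : 0 ≤ r)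
    (hrg : r < g) (f : ℤ[X]) {E : ℝ}
    (hE : ∀ A B : ℕ, A ≤ B → B ≤ q → |(((Finset.range q).filter fun n : ℕ =>
        (A : ℤ) ≤ f.eval (n : ℤ) % q ∧ f.eval (n : ℤ) % q < B).card : ℝ) - (B - A)| ≤ E) :
    discrepancy (q * g)
      (fun n => (((C r + C (g : ℤ) * f).eval (n : ℤ) : ℤ) : ℝ) / ((q * g : ℕ) : ℝ)) ≤
      (E + 1) / q := by
  classical
  have hqR : (0 : ℝ) < q := by exact_mod_cast hq
  have hgR : (0 : ℝ) < g := by exact_mod_cast hg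
  have hqZ : (0 : ℤ) < q := by exact_mod_cast hq
  have hr0' : (0 : ℝ) ≤ r := by exact_mod_cast hr0
  have hrg' : (r : ℝ) < g := by exact_mod_cast hrg
  have hE0 : 0 ≤ E := (abs_nonneg _).trans (hE 0 0 le_rfl (Nat.zero_le _))
  refine Real.sSup_le ?_ (by positivity)
  rintro _ ⟨α, β, hα, hαβ, hβ, rfl⟩
  -- Solving α ≤ (r + g y)/(q g) < β for y gives a ≤ y < b; r < g keeps both endpoints above -1.
  set a : ℝ := (α * (q * g) - r) / g with ha
  set b : ℝ := (β * (q * g) - r) / g with hb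
  have hlow : ∀ t : ℝ, 0 ≤ t → -1 < (t * (q * g) - r) / g := by
    intro t ht
    rw [lt_div_iff₀ hgR]
    have : 0 ≤ t * (q * g) := by positivity
    linarith
  have hab : ⌈a⌉₊ ≤ ⌈b⌉₊ := by
    apply Nat.ceil_mono
    rw [ha, hb]
    gcongr
  have hbq : ⌈b⌉₊ ≤ q := by
    rw [Nat.ceil_le, hb, div_le_iff₀ hgR]
    have : β * (q * g) ≤ 1 * (q * g) := by gcongr
    linarith
  have hset : {n : ℕ | n ∈ Finset.Icc 1 (q * g) ∧
      α ≤ Int.fract ((((C r + C (g : ℤ) * f).eval (n : ℤ) : ℤ) : ℝ) / ((q * g : ℕ) : ℝ)) ∧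
      Int.fract ((((C r + C (g : ℤ) * f).eval (n : ℤ) : ℤ) : ℝ) / ((q * g : ℕ) : ℝ)) < β} =
      ((Finset.Icc 1 (q * g)).filter fun n : ℕ =>
        ((⌈a⌉₊ : ℕ) : ℤ) ≤ f.eval (n : ℤ) % q ∧ f.eval (n : ℤ) % q < ((⌈b⌉₊ : ℕ) : ℤ)) := by
    ext n
    simp only [Set.mem_ofPred_eq, Finset.coe_filter]
    refine and_congr_right fun _ => ?_
    rw [eval_add, eval_mul, eval_C, eval_C, fract_eval_div_eq hg hq hr0 hrg]
    obtain ⟨y, hy⟩ := Int.eq_ofNat_of_zero_le (Int.emod_nonneg (f.eval (n : ℤ)) hqZ.ne')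
    rw [hy, Int.toNat_natCast, Int.ofNat_le, Int.ofNat_lt, Nat.ceil_le, Nat.lt_ceil, ha, hb,
      div_le_iff₀ hgR, lt_div_iff₀ hgR, Nat.cast_mul, le_div_iff₀ (by positivity),
      div_lt_iff₀ (by positivity)]
    constructor <;> rintro ⟨h1, h2⟩ <;> constructor <;> linarith
  rw [hset, Set.ncard_coe_finset, card_filter_Icc_mul_of_periodic]
  · set N := ((Finset.range q).filter fun n : ℕ =>
        ((⌈a⌉₊ : ℕ) : ℤ) ≤ f.eval (n : ℤ) % q ∧ f.eval (n : ℤ) % q < ((⌈b⌉₊ : ℕ) : ℤ)).card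
    have h1 : |(N : ℝ) - (⌈b⌉₊ - ⌈a⌉₊)| ≤ E := hE _ _ hab hbq
    have h2 := abs_ceil_sub_ceil_sub_le (hlow α hα) (hlow β (hα.trans hαβ))
    rw [← ha, ← hb] at h2
    have h3 : b - a = (β - α) * q := by rw [ha, hb]; field_simp; ring
    have h4 : ((g * N : ℕ) : ℝ) / ((q * g : ℕ) : ℝ) - (β - α) =
        (((N : ℝ) - (⌈b⌉₊ - ⌈a⌉₊)) + (((⌈b⌉₊ : ℝ) - ⌈a⌉₊) - (b - a))) / q := by
      rw [h3]; push_cast; field_simp; ring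
    rw [h4, abs_div, abs_of_pos hqR]
    gcongr
    exact (abs_add_le _ _).trans (add_le_add h1 h2)
  · intro n m
    have h1 : f.eval (((n + q * m : ℕ) : ℕ) : ℤ) % q = f.eval (n : ℤ) % q := by
      apply Int.ModEq.symm
      rw [Int.modEq_iff_dvd]
      refine dvd_trans ?_ (f.sub_dvd_eval_sub _ _)
      push_cast
      exact ⟨m, by ring⟩
    rw [h1]

theorem discrepancy_le_one {N : ℕ} (x : ℕ → ℝ) : discrepancy N x ≤ 1 := by
  refine Real.sSup_le ?_ zero_le_one
  rintro _ ⟨α, β, hα, hαβ, hβ, rfl⟩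
  have h1 : {n : ℕ | n ∈ Finset.Icc 1 N ∧ α ≤ Int.fract (x n) ∧ Int.fract (x n) < β}.ncard ≤ N := by
    calc _ ≤ ((Finset.Icc 1 N : Finset ℕ) : Set ℕ).ncard :=
          Set.ncard_le_ncard (fun n hn => hn.1) (Finset.finite_toSet _)
      _ = N := by rw [Set.ncard_coe_finset]; simp
  have h2 := div_le_one_of_le₀ (Nat.cast_le (α := ℝ).mpr h1) (Nat.cast_nonneg N)
  have h3 : 0 ≤ ({n : ℕ | n ∈ Finset.Icc 1 N ∧ α ≤ Int.fract (x n) ∧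
    Int.fract (x n) < β}.ncard : ℝ) / N := by positivity
  rw [abs_le]
  constructor <;> linarith

theorem mainTheorem9 (d : ℕ) :
    ∃ C : ℝ, 0 < C ∧ ∀ (P : Polynomial ℤ) (q : ℕ), P.natDegree = d → 0 < q →
      discrepancy q (fun n => ((P.eval (n : ℤ) : ℤ) : ℝ) / (q : ℝ)) ≤
        C * ((q : ℝ) / (coeffGcd d P q : ℝ)) ^ (-(1 / ((d : ℝ) + 1))) := by
  rcases Nat.eq_zero_or_pos d with rfl | hd
  -- For d = 0 the gcd over the empty range is 0, so `coeffGcd` equals q and the right-hand side is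
  -- 1.
  · refine ⟨1, one_pos, fun P q _ hq => (discrepancy_le_one _).trans ?_⟩
    have hq' : (q : ℝ) ≠ 0 := by exact_mod_cast hq.ne'
    simp [coeffGcd, div_self hq']
  · obtain ⟨K, hK, h⟩ := exists_abs_card_sub_le hd
    refine ⟨K + 1, by positivity, fun P q hP hq => ?_⟩
    obtain ⟨r, f, hr0, hrg, hPf, hfd, hf⟩ := exists_eq_C_add_C_mul hP hq
    have hg0 : 0 < coeffGcd d P q := coeffGcd_pos hq
    have hgq : coeffGcd d P q ∣ q := Nat.gcd_dvd_right _ _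
    generalize coeffGcd d P q = g at *
    obtain ⟨q', rfl⟩ := hgq
    have hq'0 : 0 < q' := Nat.pos_of_mul_pos_left hq
    rw [Nat.mul_div_cancel_left _ hg0] at hf
    have hgR : (g : ℝ) ≠ 0 := by exact_mod_cast hg0.ne'
    have hqR : (0 : ℝ) < q' := by exact_mod_cast hq'0
    have h1 := discrepancy_le_of_residue_count hg0 hq'0 hr0 hrg f (h q' f hq'0 hfd hf)
    rw [← hPf, mul_comm q' g] at h1
    refine h1.trans ?_
    rw [Nat.cast_mul, mul_div_cancel_left₀ _ hgR]
    have hs : 0 ≤ 1 - 1 / ((d : ℝ) + 1) := by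
      rw [sub_nonneg, div_le_one (by positivity)]
      have : (0 : ℝ) ≤ d := Nat.cast_nonneg d
      linarith
    have h2 : 1 ≤ (q' : ℝ) ^ (1 - 1 / ((d : ℝ) + 1)) :=
      Real.one_le_rpow (by exact_mod_cast hq'0) hs
    rw [div_le_iff₀ hqR]
    calc _ ≤ (K + 1) * (q' : ℝ) ^ (1 - 1 / ((d : ℝ) + 1)) := by linarith
      _ = _ := by
        rw [sub_eq_neg_add, Real.rpow_add hqR, Real.rpow_one, mul_assoc]
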